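/- \textbf{Setting.} A \emph{switched-delay system} consists of real matrices $A\in\mathbb R^{n\times n}$, $B\in\mathbb R^{n\times m}$ and a finite nonempty set $D\subset\mathbb N=\{0,1,2,\dots\}$ of delays; put $d_{\max}=\max D$. A \emph{linear delay-independent controller} is a matrix $K\in\mathbb R^{m\times(n+d_{\max}m)}$. The closed loop is driven by an arbitrary switching signal $\sigma$ with values in $D$ and is given, for $t\ge 0$, by $$x(t+1)=Ax(t)+B\sum_{s\le t,\ s+\sigma(s)=t}v(s),\qquad v(t)=K\,\tilde v(t),\qquad \tilde v(t)=\bigl(x(t),v(t-d_{\max}),\dots,v(t-1)\bigr),$$ where $s$ ranges over the integers $\ge -d_{\max}$, the signal $\sigma$ is defined on these integers, and the initial condition $\tilde v(0)=(x(0),v(-d_{\max}),\dots,v(-1))$ is arbitrary. The \emph{worst rate of growth} of the closed loop is $$\rho=\inf\{r>0:\ \text{for every initial condition } \tilde v(0) \text{ there is } C\in\mathbb R \text{ with } |\tilde v(t)|\le C r^t \text{ for all } \sigma \text{ and all } t\ge 0\}.$$ An algorithm receives $n$, $m$ and $D$ explicitly, and real inputs through rational approximations of any requested precision: the $k$-th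 approximation of a real number $x$ is an integer $z$ with $|x-z/2^k|\le 2^{-k}$, and the algorithm must succeed for every such sequence of approximations. \textbf{Corollary.} For every real $\varepsilon>0$ there is an algorithm which, given any switched-delay system $(A,B,D)$ (of any dimensions $n,m$) and any delay-independent controller $K$, halts after finitely many steps and outputs a rational number $q$ with $|q-\rho|\le\varepsilon$. More precisely, for every real $\varepsilon>0$ there is also an algorithm which, given in addition any real $r>0$, halts after finitely many steps and outputs one of the following two assertions, which is then true: \begin{itemize} \item for every initial condition there is $C\in\mathbb R$ such that $|\tilde v(t)|\le C(r+\varepsilon)^t$ for all $\sigma$ and all $t\ge 0$; \item there are a switching signal $\sigma$, an initial condition and a constant $C>0$ such that $|\tilde v(t)|\ge C\,\max(r-\varepsilon,0)^t$ for all $t\ge 0$ (with $0^0=1$). \end{itemize} -/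

import Mathlib

/-- A switched-delay system with state dimension `n` and input dimension `m`: real plant matrices
`A`, `B` and a finite nonempty set `D` of possible delays. -/
structure SwitchedDelay (n m : ℕ) where
  A : Matrix (Fin n) (Fin n) ℝ
  B : Matrix (Fin n) (Fin m) ℝ
  D : Finset ℕ
  D_nonempty : D.Nonempty

namespace SwitchedDelay

variable {n m : ℕ}

/-- The largest delay `d_max = max D`. -/
def dmax (S : SwitchedDelay n m) : ℕ := S.D.max' S.D_nonempty

/-- Index set of the extended state `(x(t), v(t - d_max), ..., v(t - 1))`; it has
`n + d_max * m` elements. -/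
abbrev ExtIdx (S : SwitchedDelay n m) : Type := Fin n ⊕ (Fin S.dmax × Fin m)

/-- A linear delay-independent controller is a matrix `K` of size `m × (n + d_max * m)`. -/
abbrev Controller (S : SwitchedDelay n m) : Type := Matrix (Fin m) S.ExtIdx ℝ

/-- The extended state `(x(t), v(t - d_max), ..., v(t - 1))` at time `t ≥ 0`. Controller outputs
are indexed by `ℤ`, because those issued at the times `-d_max, ..., -1` belong to the initial
condition. -/
def extState (S : SwitchedDelay n m) (x : ℕ → Fin n → ℝ) (v : ℤ → Fin m → ℝ) (t : ℕ) :
    S.ExtIdx → ℝ :=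
  Sum.elim (x t) (fun p => v ((t : ℤ) - (S.dmax : ℤ) + ((p.1 : ℕ) : ℤ)) p.2)

/-- The input reaching the plant at time `t`: the sum of the controller outputs `v(s)` whose
arrival time `s + σ(s)` equals `t` (it is zero if there are none). As `0 ≤ σ(s) ≤ d_max`, only
the times `s` with `t - d_max ≤ s ≤ t` can contribute. -/
noncomputable def plantInput (S : SwitchedDelay n m) (σ : ℤ → ℕ) (v : ℤ → Fin m → ℝ) (t : ℕ) : Fin m → ℝ :=
  ∑ s ∈ (Finset.Icc ((t : ℤ) - (S.dmax : ℤ)) (t : ℤ)).filter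
    (fun s : ℤ => s + (σ s : ℤ) = (t : ℤ)), v s

/-- `(x, v)` is a run, for the switching signal `σ`, of the closed loop formed by the
system `S` and the delay-independent controller `K`. -/
structure IsRun (S : SwitchedDelay n m) (K : S.Controller) (σ : ℤ → ℕ)
    (x : ℕ → Fin n → ℝ) (v : ℤ → Fin m → ℝ) : Prop where
  signal : ∀ t : ℤ, σ t ∈ S.D
  plant : ∀ t : ℕ, x (t + 1) = S.A.mulVec (x t) + S.B.mulVec (S.plantInput σ v t)
  control : ∀ t : ℕ, v (t : ℤ) = K.mulVec (S.extState x v t)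

/-- For every initial condition there is a constant `C` such that, for all switching signals and
all times, the norm of the extended state is at most `C * r ^ t`. (All norms on a
finite-dimensional space are equivalent, so the choice of the norm does not matter.) -/
def GrowthAtMost (S : SwitchedDelay n m) (K : S.Controller) (r : ℝ) : Prop :=
  ∀ ξ : S.ExtIdx → ℝ, ∃ C : ℝ, ∀ (σ : ℤ → ℕ) (x : ℕ → Fin n → ℝ) (v : ℤ → Fin m → ℝ),
    S.IsRun K σ x v → S.extState x v 0 = ξ → ∀ t : ℕ, ‖S.extState x v t‖ ≤ C * r ^ t

/-- For some switching signal and some initial condition, the norm of the extended state is at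
least `C * r ^ t` at all times, with a constant `C > 0`. -/
def GrowthAtLeast (S : SwitchedDelay n m) (K : S.Controller) (r : ℝ) : Prop :=
  ∃ (σ : ℤ → ℕ) (x : ℕ → Fin n → ℝ) (v : ℤ → Fin m → ℝ), S.IsRun K σ x v ∧
    ∃ C : ℝ, 0 < C ∧ ∀ t : ℕ, C * r ^ t ≤ ‖S.extState x v t‖

/-- The worst rate of growth of the closed loop. -/
noncomputable def worstGrowthRate (S : SwitchedDelay n m) (K : S.Controller) : ℝ :=
  sInf {r : ℝ | 0 < r ∧ S.GrowthAtMost K r}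

/-- The discrete part of an instance: the two dimensions and the list of the delays. -/
def discreteData (S : SwitchedDelay n m) : ℕ × ℕ × List ℕ := (n, m, S.D.sort (· ≤ ·))

/-- The real part of an instance: the entries of `A`, `B` and `K`, row by row. -/
noncomputable def realData (S : SwitchedDelay n m) (K : S.Controller) : List ℝ :=
  (List.ofFn fun i => List.ofFn fun j => S.A i j).flatten ++
  ((List.ofFn fun i => List.ofFn fun j => S.B i j).flatten ++
  (List.ofFn fun i =>
    (List.ofFn fun j => K i (Sum.inl j)) ++
    (List.ofFn fun d => List.ofFn fun j => K i (Sum.inr (d, j))).flatten).flatten)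

end SwitchedDelay

/-- `φ` is a name of the list `xs` of real numbers: `φ k` lists integers `z` such that `z / 2 ^ k`
approximates the corresponding real number with error at most `1 / 2 ^ k`. -/
def IsName (φ : ℕ → List ℤ) (xs : List ℝ) : Prop :=
  ∀ k : ℕ, List.Forall₂ (fun (z : ℤ) (x : ℝ) => |x - (z : ℝ) / 2 ^ k| ≤ 1 / 2 ^ k) (φ k) xs

/-- An algorithm whose input consists of discrete data in `α` and of finitely many real numbers,
the latter accessible only through rational approximations of any requested precision
(equivalently: an oracle Turing machine, or a Type-2 machine). It is given by one computable
function, which inspects the discrete data and a finite initial segment of a name, and either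
asks for a longer segment (`none`) or stops with an output. -/
structure RealAlgorithm (α β : Type) [Primcodable α] [Primcodable β] where
  step : α × List (List ℤ) → Option β
  computable : Computable step

/-- The outcome of running the algorithm on the discrete data `a` and the name `φ`: the answer
at the first initial segment of `φ` at which it stops, undefined if it never stops. -/
def RealAlgorithm.run {α β : Type} [Primcodable α] [Primcodable β] (M : RealAlgorithm α β)
    (a : α) (φ : ℕ → List ℤ) : Part β :=
  Nat.rfindOpt fun k => M.step (a, (List.range k).map φ)

/-- The rational number `p / (q + 1)` written by an algorithm as the pair `(p, q)`. -/
def fractionValue (c : ℤ × ℕ) : ℚ := (c.1 : ℚ) / ((c.2 : ℚ) + 1)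

/-! The closed loop is turned into a switched linear system without delays. A lifted state carries
the plant state, the stored outputs and the inputs still on their way, and one step multiplies it by
`liftMatrix`, which depends only on the delay of the current output. The worst rate of growth is
then the joint spectral radius of the finite family `liftFamily`, handled through `ProductsBounded F
s`. If it holds, all runs grow at most like `s ^ t` (`growthAtMost_of_productsBounded`); if it fails
for some `s > 0`, compactness gives one run growing at least like `s ^ t`
(`growthAtLeast_of_not_productsBounded`).

Both alternatives have finite certificates. Products are bounded at rate `s` if all products of some
length `L ≥ 1` have norm at most `s ^ L`. They are not bounded if, in dimension `N`, some product of
length `L` has a trace exceeding `N * s ^ L` in absolute value, since boundedness forces all its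
eigenvalues below `s ^ L` (`ProductsBounded.abs_trace_le`). Given some slack in the rate, a true
alternative always has its certificate. For norms this holds because geometric growth absorbs
constants. For traces it is a theorem of Berger–Wang type, `productsBounded_of_abs_trace_le`: the
sum of even Kronecker powers of the family is a single matrix, whose eigenvalues are controlled by
the traces of its powers and whose entries dominate powers of the entries of all products.

The certificates are strict inequalities, hence stable under small errors, and are verified in
integer arithmetic with an explicit error bound (`UpperTest`, `LowerTest`). A search over all
lengths and precisions halts because the tolerance makes the two alternatives overlap; an exact
comparison of real numbers is never needed. -/

open Matrix

attribute [local instance] Matrix.linftyOpNormedAddCommGroup Matrix.linftyOpNormedSpace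
  Matrix.linftyOpNormedRing Matrix.linftyOpNormedAlgebra

/-! ### Products of a finite family of matrices: contraction and compactness -/

section SwitchedProducts

set_option linter.unusedSectionVars false

variable {ι κ : Type*} [Fintype κ] [DecidableEq κ]

/-- All products of the matrices `F a` are bounded by a constant times `s ^ length`. -/
def ProductsBounded (F : ι → Matrix κ κ ℝ) (s : ℝ) : Prop :=
  ∃ C : ℝ, ∀ w : List ι, ‖(w.map F).prod‖ ≤ C * s ^ w.length

/-- The action of a word on a vector, its first letter being applied first. -/
def wordAct (F : ι → Matrix κ κ ℝ) (w : List ι) (y : κ → ℝ) : κ → ℝ :=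
  w.foldl (fun y a => F a *ᵥ y) y

theorem wordAct_append (F : ι → Matrix κ κ ℝ) (u w : List ι) (y : κ → ℝ) :
    wordAct F (u ++ w) y = wordAct F w (wordAct F u y) :=
  List.foldl_append

theorem wordAct_eq_mulVec (F : ι → Matrix κ κ ℝ) (w : List ι) (y : κ → ℝ) :
    wordAct F w y = (w.reverse.map F).prod *ᵥ y := by
  induction w generalizing y with
  | nil => simp [wordAct]
  | cons a w ih =>
    have : wordAct F (a :: w) y = wordAct F w (F a *ᵥ y) := rfl
    rw [this, ih]
    simp [Matrix.mulVec_mulVec]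

theorem wordAct_smul (F : ι → Matrix κ κ ℝ) (w : List ι) (c : ℝ) (y : κ → ℝ) :
    wordAct F w (c • y) = c • wordAct F w y := by
  simp only [wordAct_eq_mulVec, Matrix.mulVec_smul]

theorem norm_le_of_mulVec_le (M : Matrix κ κ ℝ) {C : ℝ} (hC : 0 ≤ C)
    (h : ∀ y, ‖M *ᵥ y‖ ≤ C * ‖y‖) : ‖M‖ ≤ C := by
  rw [Matrix.linfty_opNorm_eq_opNorm]
  exact ContinuousLinearMap.opNorm_le_bound _ hC h

theorem norm_entry_le {R : Type*} [NormedRing R] (M : Matrix κ κ R) (i j : κ) : ‖M i j‖ ≤ ‖M‖ := by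
  have h : ‖M i j‖₊ ≤ ‖M‖₊ := by
    rw [Matrix.linfty_opNNNorm_def]
    exact (Finset.single_le_sum (f := fun j => ‖M i j‖₊) (fun _ _ => zero_le) (Finset.mem_univ j)).trans
      (Finset.le_sup (f := fun i => ∑ j, ‖M i j‖₊) (Finset.mem_univ i))
  exact h

theorem norm_le_card_mul {R : Type*} [NormedRing R] (M : Matrix κ κ R) {c : ℝ} (hc : 0 ≤ c)
    (h : ∀ i j, ‖M i j‖ ≤ c) : ‖M‖ ≤ Fintype.card κ * c := by
  lift c to NNReal using hc
  have : ‖M‖₊ ≤ Fintype.card κ * c := by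
    rw [Matrix.linfty_opNNNorm_def]
    refine Finset.sup_le fun i _ => ?_
    calc ∑ j, ‖M i j‖₊ ≤ ∑ _j : κ, c := Finset.sum_le_sum fun j _ => h i j
      _ = Fintype.card κ * c := by simp
  exact_mod_cast this

variable [Fintype ι]

theorem norm_wordAct_le (F : ι → Matrix κ κ ℝ) (w : List ι) (y : κ → ℝ) :
    ‖wordAct F w y‖ ≤ (∑ a, ‖F a‖) ^ w.length * ‖y‖ := by
  induction w generalizing y with
  | nil => simp [wordAct]
  | cons a w ih =>
    have h1 : wordAct F (a :: w) y = wordAct F w (F a *ᵥ y) := rfl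
    have h2 : ‖F a *ᵥ y‖ ≤ (∑ a, ‖F a‖) * ‖y‖ :=
      (Matrix.linfty_opNorm_mulVec _ _).trans (mul_le_mul_of_nonneg_right
        (Finset.single_le_sum (f := fun a => ‖F a‖) (fun _ _ => norm_nonneg _) (Finset.mem_univ a))
        (norm_nonneg _))
    rw [h1, List.length_cons, pow_succ, mul_assoc]
    exact (ih _).trans (mul_le_mul_of_nonneg_left h2 (by positivity))

/-- A trajectory is cut at successive times at which it has contracted relative to `s`. Only the
last piece, of length at most `L`, is uncontrolled, and it costs the constant factor `γ ^ L`. The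
contraction time may depend on the word and the vector, which is the form the compactness argument
needs. -/
theorem productsBounded_of_contraction (F : ι → Matrix κ κ ℝ) {s : ℝ} (hs : 0 < s) (L : ℕ)
    (h : ∀ w : List ι, w.length = L → ∀ y : κ → ℝ,
      ∃ k, 1 ≤ k ∧ k ≤ L ∧ ‖wordAct F (w.take k) y‖ ≤ s ^ k * ‖y‖) :
    ProductsBounded F s := by
  set β := ∑ a, ‖F a‖ with hβ
  have hβ0 : 0 ≤ β := Finset.sum_nonneg fun _ _ => norm_nonneg _
  set γ := max 1 (β / s) with hγ
  have hγ1 : 1 ≤ γ := le_max_left _ _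
  have hβγ : β ≤ γ * s := by
    rw [← div_le_iff₀ hs]; exact le_max_right _ _
  have key : ∀ t : ℕ, ∀ w : List ι, w.length = t → ∀ y, ‖wordAct F w y‖ ≤ γ ^ L * s ^ t * ‖y‖ := by
    intro t
    induction t using Nat.strong_induction_on with
    | _ t ih =>
      intro w hw y
      rcases le_or_gt t L with htL | htL
      · calc ‖wordAct F w y‖ ≤ β ^ t * ‖y‖ := hw ▸ norm_wordAct_le F w y
          _ ≤ (γ * s) ^ t * ‖y‖ := by gcongr
          _ ≤ γ ^ L * s ^ t * ‖y‖ := by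
            rw [mul_pow]
            have := pow_le_pow_right₀ hγ1 htL
            gcongr
      · obtain ⟨k, hk1, hkL, hk⟩ := h (w.take L) (by simp; omega) y
        rw [List.take_take, min_eq_left hkL] at hk
        have e : wordAct F w y = wordAct F (w.drop k) (wordAct F (w.take k) y) := by
          rw [← wordAct_append, List.take_append_drop]
        have := ih (t - k) (by omega) (w.drop k) (by simp [hw]) (wordAct F (w.take k) y)
        rw [e]
        calc _ ≤ _ := this
          _ ≤ γ ^ L * s ^ (t - k) * (s ^ k * ‖y‖) := by gcongr
          _ = γ ^ L * s ^ t * ‖y‖ := by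
            rw [show s ^ t = s ^ (t - k) * s ^ k by rw [← pow_add]; congr 1; omega]; ring
  refine ⟨γ ^ L, fun w => norm_le_of_mulVec_le _ (by positivity) fun y => ?_⟩
  have := key w.reverse.length w.reverse rfl y
  rwa [wordAct_eq_mulVec, List.reverse_reverse, List.length_reverse] at this

theorem productsBounded_of_norm_le_pow (F : ι → Matrix κ κ ℝ) {s : ℝ} (hs : 0 < s) {L : ℕ}
    (hL : 1 ≤ L) (h : ∀ w : List ι, w.length = L → ‖(w.map F).prod‖ ≤ s ^ L) :
    ProductsBounded F s := by
  refine productsBounded_of_contraction F hs L fun w hw y => ⟨L, hL, le_rfl, ?_⟩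
  rw [List.take_of_length_le hw.le, wordAct_eq_mulVec]
  exact (Matrix.linfty_opNorm_mulVec _ _).trans
    (mul_le_mul_of_nonneg_right (h _ (by simpa using hw)) (norm_nonneg _))

theorem exists_productsBounded (F : ι → Matrix κ κ ℝ) : ∃ s : ℝ, 0 < s ∧ ProductsBounded F s := by
  have h0 : 0 ≤ ∑ a, ‖F a‖ := Finset.sum_nonneg fun _ _ => norm_nonneg _
  refine ⟨∑ a, ‖F a‖ + 1, by positivity, 1, fun w => norm_le_of_mulVec_le _ (by positivity) fun y => ?_⟩
  have := norm_wordAct_le F w.reverse y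
  rw [wordAct_eq_mulVec, List.reverse_reverse, List.length_reverse] at this
  refine this.trans ?_
  rw [one_mul]
  gcongr
  linarith

/-- If the products are not bounded at rate `s`, then compactness yields an infinite trajectory
that never falls below the growth `s ^ t`. -/
theorem exists_trajectory_of_not_productsBounded (F : ι → Matrix κ κ ℝ) {s : ℝ} (hs : 0 < s)
    (h : ¬ ProductsBounded F s) :
    ∃ (a : ℕ → ι) (y : ℕ → κ → ℝ), y 0 ≠ 0 ∧ (∀ t, y (t + 1) = F (a t) *ᵥ y t) ∧
      ∀ t, s ^ t * ‖y 0‖ ≤ ‖y t‖ := by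
  let traj : (κ → ℝ) × (ℕ → ι) → ℕ → κ → ℝ := fun p t =>
    Nat.rec p.1 (fun t y => F (p.2 t) *ᵥ y) t
  have traj_succ : ∀ p t, traj p (t + 1) = F (p.2 t) *ᵥ traj p t := fun p t => rfl
  have traj_act : ∀ p t, traj p t = wordAct F ((List.range t).map p.2) p.1 := by
    intro p t
    induction t with
    | zero => rfl
    | succ t ih =>
      rw [traj_succ, ih, List.range_succ, List.map_append, wordAct_append]; rfl
  -- With the discrete topology on the finite set `ι`, the space of switching sequences is compact.
  let _ : TopologicalSpace ι := ⊥
  have : DiscreteTopology ι := ⟨rfl⟩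
  have hcont : ∀ t, Continuous fun p => traj p t := by
    intro t
    induction t with
    | zero => exact continuous_fst
    | succ t ih =>
      have h1 : Continuous fun p : (κ → ℝ) × (ℕ → ι) => F (p.2 t) :=
        (continuous_of_discreteTopology (f := F)).comp ((continuous_apply t).comp continuous_snd)
      exact h1.matrix_mulVec ih
  -- `Z L` collects the unit initial vectors and switching sequences that stay above `s ^ k` up to
  -- time `L`. These sets are compact and decreasing, and a common point is the required trajectory.
  let Z : ℕ → Set ((κ → ℝ) × (ℕ → ι)) := fun L =>
    (Metric.sphere 0 1 ×ˢ Set.univ) ∩ ⋂ k ∈ Set.Iic L, {p | s ^ k ≤ ‖traj p k‖}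
  have hcomp : IsCompact (Metric.sphere (0 : κ → ℝ) 1 ×ˢ (Set.univ : Set (ℕ → ι))) :=
    (isCompact_sphere 0 1).prod isCompact_univ
  have hclosed : ∀ L, IsClosed (⋂ k ∈ Set.Iic L, {p | s ^ k ≤ ‖traj p k‖}) := fun L =>
    isClosed_biInter fun k _ => isClosed_le continuous_const (hcont k).norm
  have hne : ∀ L, (Z L).Nonempty := by
    intro L
    by_contra hL
    apply h
    -- Length `L + 1` makes the word nonempty, so that its first letter can pad it to an infinite
    -- sequence.
    refine productsBounded_of_contraction F hs (L + 1) fun w hw y => ?_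
    by_contra! hc
    have hy : y ≠ 0 := by
      rintro rfl
      have h1 := hc 1 le_rfl (by omega)
      have : wordAct F (w.take 1) 0 = 0 := by rw [wordAct_eq_mulVec, Matrix.mulVec_zero]
      rw [this] at h1
      simp at h1
    have hy' : 0 < ‖y‖ := norm_pos_iff.mpr hy
    have hw0 : 0 < w.length := by omega
    let p : (κ → ℝ) × (ℕ → ι) := (‖y‖⁻¹ • y, fun i => w.getD i (w[0]))
    apply hL
    refine ⟨p, ⟨⟨?_, trivial⟩, ?_⟩⟩
    · simp [p, norm_smul, hy'.ne']
    · simp only [Set.mem_iInter, Set.mem_Iic, Set.mem_ofPred_eq]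
      intro k hk
      have e : (List.range k).map p.2 = w.take k := by
        apply List.ext_getElem
        · simp; omega
        · intro i h1 h2
          have : i < w.length := by simp at h2; omega
          simp [p, this]
      rw [traj_act, e, wordAct_smul, norm_smul, norm_inv, norm_norm]
      rcases Nat.eq_zero_or_pos k with rfl | hk0
      · simp [wordAct, hy'.ne']
      · have := hc k hk0 (by omega)
        rw [inv_mul_eq_div, le_div_iff₀ hy']
        exact this.le
  obtain ⟨p, hp⟩ := IsCompact.nonempty_iInter_of_sequence_nonempty_isCompact_isClosed Z
    (fun L => Set.inter_subset_inter_right _ (Set.biInter_subset_biInter_left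
      (Set.Iic_subset_Iic.mpr (Nat.le_succ L)))) hne (hcomp.inter_right (hclosed 0))
    (fun L => hcomp.isClosed.inter (hclosed L))
  have hp' : ∀ L, p ∈ Z L := fun L => Set.mem_iInter.mp hp L
  have hn : ‖p.1‖ = 1 := by simpa using (hp' 0).1.1
  refine ⟨p.2, traj p, ?_, traj_succ p, fun t => ?_⟩
  · intro h0
    have : ‖p.1‖ = 0 := by rw [show p.1 = 0 from h0, norm_zero]
    rw [hn] at this
    exact one_ne_zero this
  · have h0 : ‖traj p 0‖ = 1 := hn
    rw [h0, mul_one]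
    have := (hp' t).2
    simp only [Set.mem_iInter, Set.mem_Iic, Set.mem_ofPred_eq] at this
    exact this t le_rfl

end SwitchedProducts

/-! ### Eigenvalues, powers and traces of a single matrix -/

theorem le_of_forall_pow_le_mul_pow {x C R : ℝ} (hR : 0 ≤ R)
    (h : ∀ k : ℕ, x ^ k ≤ C * R ^ k) : x ≤ R := by
  by_contra! hlt
  rcases hR.eq_or_lt with rfl | hR'
  · have := h 1
    simp at this
    linarith
  · obtain ⟨k, hk⟩ := pow_unbounded_of_one_lt C ((one_lt_div hR').mpr hlt)
    rw [div_pow, lt_div_iff₀ (by positivity)] at hk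
    exact absurd (h k) (not_le.mpr hk)

section Spectral

variable {κ : Type*} [Fintype κ] [DecidableEq κ]

theorem norm_le_of_mem_spectrum_of_norm_pow_le (M : Matrix κ κ ℂ) {C R : ℝ} (hR : 0 ≤ R)
    (h : ∀ k : ℕ, ‖M ^ k‖ ≤ C * R ^ k) {z : ℂ} (hz : z ∈ spectrum ℂ M) : ‖z‖ ≤ R := by
  refine le_of_forall_pow_le_mul_pow (C := C * ‖(1 : Matrix κ κ ℂ)‖) hR fun k => ?_
  have h1 := spectrum.norm_le_norm_mul_of_mem (spectrum.pow_mem_pow M k hz)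
  rw [norm_pow] at h1
  calc ‖z‖ ^ k ≤ ‖M ^ k‖ * ‖(1 : Matrix κ κ ℂ)‖ := h1
    _ ≤ C * R ^ k * ‖(1 : Matrix κ κ ℂ)‖ := by gcongr; exact h k
    _ = _ := by ring

theorem norm_trace_le_of_forall_mem_spectrum (M : Matrix κ κ ℂ) {R : ℝ} (hR : 0 ≤ R)
    (h : ∀ z ∈ spectrum ℂ M, ‖z‖ ≤ R) : ‖M.trace‖ ≤ Fintype.card κ * R := by
  rw [Matrix.trace_eq_sum_roots_charpoly]
  refine (norm_multiset_sum_le _).trans ?_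
  have h1 : (M.charpoly.roots.map fun z => ‖z‖).sum ≤ (M.charpoly.roots.map fun z => ‖z‖).card • R := by
    refine Multiset.sum_le_card_nsmul _ _ fun x hx => ?_
    obtain ⟨z, hz, rfl⟩ := Multiset.mem_map.mp hx
    exact h z (Matrix.mem_spectrum_of_isRoot_charpoly (Polynomial.isRoot_of_mem_roots hz))
  refine h1.trans ?_
  rw [nsmul_eq_mul, Multiset.card_map]
  gcongr
  rw [← Matrix.charpoly_natDegree_eq_dim M]
  exact Polynomial.card_roots' _

open Polynomial in
/-- The spectral projection onto a generalized eigenspace, as a polynomial in the matrix. -/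
theorem exists_spectral_idempotent (M : Matrix κ κ ℂ) {z : ℂ} (hz : z ∈ spectrum ℂ M) :
    ∃ f : ℂ[X], aeval M f ≠ 0 ∧ IsIdempotentElem (aeval M f) ∧
      IsNilpotent (aeval M ((X - C z) * f)) := by
  have hroot : M.charpoly.IsRoot z := Matrix.mem_spectrum_iff_isRoot_charpoly.mp hz
  obtain ⟨g, hg, hndvd⟩ :=
    M.charpoly.exists_eq_pow_rootMultiplicity_mul_and_not_dvd M.charpoly_monic.ne_zero z
  set a := M.charpoly.rootMultiplicity z with ha
  have ha0 : 0 < a := (rootMultiplicity_pos M.charpoly_monic.ne_zero).mpr hroot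
  have hcop : IsCoprime ((X - C z) ^ a) g :=
    (((irreducible_X_sub_C z).coprime_iff_not_dvd).mpr hndvd).pow_left
  obtain ⟨u, v, huv⟩ := hcop
  have hzero : aeval M ((X - C z) ^ a * g) = 0 := by
    rw [← hg]; exact Matrix.aeval_self_charpoly M
  -- By the Bézout identity `v * g` is `1` modulo `(X - z) ^ a` and `0` modulo `g`; the product of
  -- these two moduli is the characteristic polynomial, which kills `M` by Cayley–Hamilton.
  refine ⟨v * g, ?_, ?_, a, ?_⟩
  · intro h0
    have h1 : aeval M (u * (X - C z) ^ a) = 1 := by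
      have := congrArg (aeval M) huv
      rwa [map_add, h0, add_zero, map_one] at this
    have h2 : aeval M (u * (X - C z) ^ (a - 1)) * aeval M (X - C z) = 1 := by
      rw [← map_mul, mul_assoc, ← pow_succ, Nat.sub_add_cancel ha0, h1]
    have h3 : aeval M (X - C z) * aeval M (u * (X - C z) ^ (a - 1)) = 1 := by
      rw [← map_mul, mul_comm, map_mul, h2]
    have hu : IsUnit (aeval M (X - C z)) := ⟨⟨_, _, h3, h2⟩, rfl⟩
    rw [spectrum.mem_iff] at hz
    apply hz
    rw [← IsUnit.neg_iff]
    convert! hu using 1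
    simp
  · have : v * g * (v * g) = v * g - v * u * ((X - C z) ^ a * g) := by
      linear_combination (v * g) * huv
    rw [IsIdempotentElem, ← map_mul, this, map_sub, map_mul _ (v * u), hzero, mul_zero, sub_zero]
  · have : ((X - C z) * (v * g)) ^ a = v ^ a * g ^ (a - 1) * ((X - C z) ^ a * g) := by
      rw [mul_pow, mul_pow]
      conv_lhs => rw [← Nat.sub_add_cancel ha0, pow_succ g, Nat.sub_add_cancel ha0]
      ring
    rw [← map_pow, this, map_mul, hzero, mul_zero]

open Polynomial in
/-- If the traces of the powers grow at most like `R ^ k`, no eigenvalue exceeds `R`. -/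
theorem norm_le_of_mem_spectrum_of_norm_trace_pow_le (M : Matrix κ κ ℂ) {c R : ℝ} (hR : 0 ≤ R)
    (h : ∀ k : ℕ, ‖(M ^ k).trace‖ ≤ c * R ^ k) {z : ℂ} (hz : z ∈ spectrum ℂ M) : ‖z‖ ≤ R := by
  obtain ⟨f, hf0, hfi, hfn⟩ := exists_spectral_idempotent M hz
  -- In characteristic zero an idempotent of trace zero vanishes.
  have htr0 : (aeval M f).trace ≠ 0 := by
    intro h0
    have h1 : IsIdempotentElem (Matrix.toLin' (aeval M f)) := by
      rw [IsIdempotentElem, Module.End.mul_eq_comp, ← Matrix.toLin'_mul, hfi]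
    have h2 := LinearMap.IsIdempotentElem.trace_eq_zero_iff h1
    rw [Matrix.trace_toLin'_eq, h0] at h2
    exact hf0 (Matrix.toLin'.map_eq_zero_iff.mp (h2.mp rfl))
  -- On the range of the projection `M` is `z` plus a nilpotent, and nilpotents have trace zero. The
  -- projected traces are thus exactly geometric with ratio `z`, and no cancellation between
  -- eigenvalues can hide `z`.
  have hpow : ∀ k : ℕ, (aeval M f * M ^ k).trace = z ^ k * (aeval M f).trace := by
    intro k
    obtain ⟨g, hg⟩ := sub_dvd_pow_sub_pow (X : ℂ[X]) (C z) k
    have hn : IsNilpotent (aeval M (f * X ^ k - C (z ^ k) * f)) := by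
      have e : f * X ^ k - C (z ^ k) * f = g * ((X - C z) * f) := by
        rw [C_pow]; linear_combination f * hg
      rw [e, map_mul]
      refine Commute.isNilpotent_mul_left ?_ hfn
      rw [commute_iff_eq, ← map_mul, ← map_mul, mul_comm]
    have := (Matrix.isNilpotent_trace_of_isNilpotent hn).eq_zero
    rw [map_sub, Matrix.trace_sub, sub_eq_zero] at this
    simpa [Algebra.algebraMap_eq_smul_one, Matrix.trace_smul, _root_.smul_pow] using this
  have hbound : ∀ k : ℕ, ‖(aeval M f * M ^ k).trace‖ ≤
      (∑ i ∈ Finset.range (f.natDegree + 1), ‖f.coeff i‖ * (c * R ^ i)) * R ^ k := by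
    intro k
    rw [aeval_eq_sum_range, Finset.sum_mul, Matrix.trace_sum, Finset.sum_mul]
    refine (norm_sum_le _ _).trans (Finset.sum_le_sum fun i _ => ?_)
    rw [smul_mul_assoc, ← pow_add, Matrix.trace_smul, smul_eq_mul, norm_mul, mul_assoc]
    gcongr
    rw [mul_assoc, ← pow_add]
    exact h _
  refine le_of_forall_pow_le_mul_pow
    (C := (∑ i ∈ Finset.range (f.natDegree + 1), ‖f.coeff i‖ * (c * R ^ i)) /
      ‖(aeval M f).trace‖) hR fun k => ?_
  rw [div_mul_eq_mul_div, le_div_iff₀ (norm_pos_iff.mpr htr0), ← norm_pow, ← norm_mul, ← hpow]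
  exact hbound k

/-- A consequence of Gelfand's formula. -/
theorem exists_norm_pow_le_of_forall_mem_spectrum (M : Matrix κ κ ℂ) {R R' : ℝ} (hR : 0 ≤ R)
    (hRR' : R < R') (h : ∀ z ∈ spectrum ℂ M, ‖z‖ ≤ R) :
    ∃ C : ℝ, ∀ k : ℕ, ‖M ^ k‖ ≤ C * R' ^ k := by
  have hR' : 0 < R' := hR.trans_lt hRR'
  have h1 : spectralRadius ℂ M < ENNReal.ofReal R' := by
    refine lt_of_le_of_lt (b := ENNReal.ofReal R) (iSup₂_le fun z hz => ?_)
      ((ENNReal.ofReal_lt_ofReal_iff hR').mpr hRR')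
    rw [← ENNReal.ofReal_coe_nnreal]
    exact ENNReal.ofReal_le_ofReal (h z hz)
  have h2 := (spectrum.pow_norm_pow_one_div_tendsto_nhds_spectralRadius M).eventually_lt_const h1
  obtain ⟨K, hK⟩ := Filter.eventually_atTop.mp h2
  refine ⟨1 + ∑ i ∈ Finset.range (K + 1), ‖M ^ i‖ / R' ^ i, fun k => ?_⟩
  have hnn : ∀ i ∈ Finset.range (K + 1), 0 ≤ ‖M ^ i‖ / R' ^ i := fun i _ => by positivity
  have hsum := Finset.sum_nonneg hnn
  rcases le_or_gt k K with hk | hk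
  · have := Finset.single_le_sum hnn (Finset.mem_range.mpr (Nat.lt_succ_of_le hk))
    rw [← div_le_iff₀ (by positivity)]
    linarith
  · have h3 := (ENNReal.ofReal_lt_ofReal_iff hR').mp (hK k hk.le)
    have hk0 : (k : ℝ) ≠ 0 := by have : 0 < k := by omega
                                 positivity
    have h4 : ‖M ^ k‖ ≤ R' ^ k := by
      have := pow_le_pow_left₀ (by positivity) h3.le k
      rwa [← Real.rpow_natCast, ← Real.rpow_mul (norm_nonneg _), one_div_mul_cancel hk0,
        Real.rpow_one] at this
    calc ‖M ^ k‖ ≤ 1 * R' ^ k := by simpa using h4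
      _ ≤ _ := by gcongr; linarith

end Spectral

/-! ### Growth of products from growth of traces, by Kronecker powers -/

section TraceCriterion

set_option linter.unusedSectionVars false

variable {ι κ : Type*} [Fintype ι] [Fintype κ] [DecidableEq κ]

theorem sum_pow_eq_sum_prod_ofFn {R : Type*} [Semiring R] (f : ι → R) (k : ℕ) :
    (∑ a, f a) ^ k = ∑ w : Fin k → ι, ((List.ofFn w).map f).prod := by
  induction k with
  | zero => simp
  | succ k ih =>
    rw [pow_succ', ih, Finset.sum_mul_sum, ← (Fin.consEquiv fun _ => ι).sum_comp,
      Fintype.sum_prod_type]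
    simp [List.ofFn_succ]

/-- The `p`-fold Kronecker power. -/
def kroneckerPow (p : ℕ) (κ : Type*) [Fintype κ] [DecidableEq κ] :
    Matrix κ κ ℝ →* Matrix (Fin p → κ) (Fin p → κ) ℝ where
  toFun X := Matrix.of fun I J => ∏ i, X (I i) (J i)
  map_one' := by
    ext I J
    simp only [Matrix.of_apply, Matrix.one_apply]
    rw [Finset.prod_ite_zero]
    simp [funext_iff]
  map_mul' X Y := by
    ext I J
    simp only [Matrix.of_apply, Matrix.mul_apply]
    rw [Fintype.prod_sum]
    simp [Finset.prod_mul_distrib]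

theorem kroneckerPow_apply (p : ℕ) (X : Matrix κ κ ℝ) (I J : Fin p → κ) :
    kroneckerPow p κ X I J = ∏ i, X (I i) (J i) := rfl

theorem trace_kroneckerPow (p : ℕ) (X : Matrix κ κ ℝ) :
    (kroneckerPow p κ X).trace = X.trace ^ p := by
  simp only [Matrix.trace, Matrix.diag, kroneckerPow_apply]
  exact (Fintype.sum_pow (fun i => X i i) p).symm

theorem sum_kroneckerPow_pow (F : ι → Matrix κ κ ℝ) (p k : ℕ) :
    (∑ a, kroneckerPow p κ (F a)) ^ k =
      ∑ w : Fin k → ι, kroneckerPow p κ (((List.ofFn w).map F).prod) := by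
  rw [sum_pow_eq_sum_prod_ofFn]
  refine Finset.sum_congr rfl fun w _ => ?_
  rw [map_list_prod, List.map_map]
  rfl

theorem norm_map_ofReal (M : Matrix κ κ ℝ) :
    ‖Complex.ofRealHom.mapMatrix M‖ = ‖M‖ := by
  simp [Matrix.linfty_opNorm_def, RingHom.mapMatrix_apply, Matrix.map_apply]

theorem trace_map_ofReal (M : Matrix κ κ ℝ) :
    (Complex.ofRealHom.mapMatrix M).trace = (M.trace : ℂ) :=
  (AddMonoidHom.map_trace Complex.ofRealHom M).symm

/-- Applied to repetitions of `w`, boundedness controls all powers of one product, hence its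
eigenvalues. The constant of `ProductsBounded` disappears in this way, so a single product with a
larger trace refutes boundedness. -/
theorem ProductsBounded.abs_trace_le {F : ι → Matrix κ κ ℝ} {s : ℝ} (hs : 0 ≤ s)
    (h : ProductsBounded F s) (w : List ι) :
    |(w.map F).prod.trace| ≤ Fintype.card κ * s ^ w.length := by
  obtain ⟨C, hC⟩ := h
  have h1 : ∀ k : ℕ, ‖Complex.ofRealHom.mapMatrix (w.map F).prod ^ k‖ ≤ C * (s ^ w.length) ^ k := by
    intro k
    rw [← map_pow, norm_map_ofReal]
    have := hC (List.replicate k w).flatten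
    simpa [List.map_flatten, List.prod_flatten, ← pow_mul, mul_comm] using this
  have h2 := norm_trace_le_of_forall_mem_spectrum _ (pow_nonneg hs w.length) fun z hz =>
    norm_le_of_mem_spectrum_of_norm_pow_le _ (pow_nonneg hs _) h1 hz
  rwa [trace_map_ofReal, Complex.norm_real, Real.norm_eq_abs] at h2

/-- The growth of the products is governed by the growth of their traces. -/
theorem productsBounded_of_abs_trace_le (F : ι → Matrix κ κ ℝ) {c s s' : ℝ} (hs : 0 < s)
    (hss' : s < s') (h : ∀ w : List ι, |(w.map F).prod.trace| ≤ c * s ^ w.length) :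
    ProductsBounded F s' := by
  have hs' : 0 < s' := hs.trans hss'
  obtain ⟨p₀, hp₀⟩ := pow_unbounded_of_one_lt (Fintype.card ι : ℝ) ((one_lt_div hs).mpr hss')
  -- An even `p` makes the `p`-th powers of the entries nonnegative, so nothing cancels in the sum
  -- over words. A large `p` lets `(s' / s) ^ (p * k)` outweigh the number of words of length `k`.
  set p := 2 * (p₀ + 1) with hp
  have hpe : Even p := even_two_mul _
  have hp0 : p ≠ 0 := by omega
  have hlt : Fintype.card ι * s ^ p < s' ^ p := by
    have h1 : (Fintype.card ι : ℝ) < (s' / s) ^ p :=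
      hp₀.trans_le (pow_le_pow_right₀ ((one_lt_div hs).mpr hss').le (by omega))
    rwa [div_pow, lt_div_iff₀ (by positivity)] at h1
  set M := ∑ a, kroneckerPow p κ (F a) with hM
  have htr : ∀ k : ℕ, ‖(Complex.ofRealHom.mapMatrix M ^ k).trace‖ ≤
      |c| ^ p * (Fintype.card ι * s ^ p) ^ k := by
    intro k
    rw [← map_pow, trace_map_ofReal, Complex.norm_real, hM, sum_kroneckerPow_pow,
      Matrix.trace_sum]
    refine (norm_sum_le _ _).trans ?_
    calc _ ≤ ∑ _w : Fin k → ι, (|c| * s ^ k) ^ p := by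
          refine Finset.sum_le_sum fun w _ => ?_
          rw [trace_kroneckerPow, norm_pow, Real.norm_eq_abs]
          refine pow_le_pow_left₀ (abs_nonneg _) ((h _).trans ?_) p
          rw [List.length_ofFn]
          gcongr
          exact le_abs_self c
      _ = _ := by
          simp only [Finset.sum_const, Finset.card_univ, Fintype.card_fun, Fintype.card_fin,
            nsmul_eq_mul]
          push_cast
          ring
  obtain ⟨C, hC⟩ := exists_norm_pow_le_of_forall_mem_spectrum (Complex.ofRealHom.mapMatrix M)
    (by positivity) hlt fun z hz =>
      norm_le_of_mem_spectrum_of_norm_trace_pow_le _ (by positivity) htr hz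
  have hC1 : 1 ≤ max C 1 := le_max_right _ _
  refine ⟨Fintype.card κ * max C 1, fun w => ?_⟩
  rw [mul_assoc]
  refine norm_le_card_mul _ (by positivity) fun i j => ?_
  refine le_of_pow_le_pow_left₀ hp0 (by positivity) ?_
  set k := w.length with hk
  -- At constant multi-indices the Kronecker power has the entry `(w.map F).prod i j ^ p`, which is
  -- one of the nonnegative summands of the entry of `M ^ k`.
  have hentry : (w.map F).prod i j ^ p ≤ (M ^ k) (fun _ => i) (fun _ => j) := by
    rw [hM, sum_kroneckerPow_pow, Matrix.sum_apply]
    have := Finset.single_le_sum (f := fun w : Fin k → ι =>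
      kroneckerPow p κ (((List.ofFn w).map F).prod) (fun _ => i) (fun _ => j))
      (fun w _ => by
        rw [kroneckerPow_apply, Finset.prod_const, Finset.card_univ, Fintype.card_fin]
        exact hpe.pow_nonneg (((List.ofFn w).map F).prod i j)) (Finset.mem_univ w.get)
    simpa [kroneckerPow_apply, List.ofFn_get] using this
  calc ‖(w.map F).prod i j‖ ^ p = (w.map F).prod i j ^ p := by
        rw [Real.norm_eq_abs, hpe.pow_abs]
    _ ≤ (M ^ k) (fun _ => i) (fun _ => j) := hentry
    _ ≤ ‖M ^ k‖ := (le_abs_self _).trans (norm_entry_le (M ^ k) _ _)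
    _ ≤ C * (s' ^ p) ^ k := by rw [← norm_map_ofReal, map_pow]; exact hC k
    _ ≤ max C 1 ^ p * (s' ^ p) ^ k := by
        gcongr
        exact (le_max_left C 1).trans (le_self_pow₀ hC1 hp0)
    _ = (max C 1 * s' ^ k) ^ p := by ring

end TraceCriterion

/-! ### Positions in flattened lists of rows -/

theorem List.getD_flatten_ofFn {α : Type*} {r c : ℕ} (f : Fin r → List α) (hf : ∀ i, (f i).length = c)
    (i : Fin r) {j : ℕ} (hj : j < c) (x : α) :
    (List.ofFn f).flatten.getD (i * c + j) x = (f i).getD j x := by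
  induction r with
  | zero => exact i.elim0
  | succ r ih =>
    rw [List.ofFn_succ, List.flatten_cons]
    refine Fin.cases ?_ (fun i => ?_) i
    · rw [List.getD_append _ _ _ _ (by simp [hf, hj])]
      simp
    · rw [List.getD_append_right _ _ _ _ (by rw [hf, Fin.val_succ, Nat.add_mul]; omega),
        ← ih (fun i => f i.succ) (fun i => hf _)]
      congr 1
      rw [hf, Fin.val_succ, Nat.add_mul]
      omega

theorem List.length_flatten_ofFn {α : Type*} {r c : ℕ} (f : Fin r → List α)
    (hf : ∀ i, (f i).length = c) : (List.ofFn f).flatten.length = r * c := by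
  have : (List.ofFn f).map List.length = List.replicate r c := by
    rw [List.map_ofFn, ← List.ofFn_const]
    congr 1
    funext i
    exact hf i
  rw [List.length_flatten, this, List.sum_replicate, smul_eq_mul]

/-! ### The matrices of the lifted system -/

/-- The dimension of the lifted state: `n` plant coordinates followed by `2 * (d + 1)` blocks of
size `m`. The blocks `0, ..., d` hold controller outputs, the blocks `d + 1, ..., 2 * d + 1` the
pending plant inputs. -/
def liftDim (n m d : ℕ) : ℕ := n + 2 * (d + 1) * m

section Lift

variable {R : Type*}

/-- The entries of the matrix that applies the plant equation and shifts the blocks. -/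
def plantEntry [Zero R] (n m d : ℕ) (one : R) (z : ℕ → R) (i j : ℕ) : R :=
  -- The parameter `one` is `1` for the real matrices and `2 ^ k` for the integer matrices at scale
  -- `2 ^ k`.
  if i < n then
    if j < n then z (i * n + j)
    else if (j - n) / m = d + 1 then z (n * n + (i * m + (j - n) % m)) else 0
  -- Block `q` receives block `q + 1`. Block `d`, which only holds the current output within a step,
  -- is cleared instead of receiving pending inputs; the last block has its source out of range and
  -- becomes zero.
  else if (i - n) / m ≠ d ∧ j = i + m then one else 0

/-- The entries of the matrix that evaluates the controller, stores its output in the block `d` and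
adds it to the input pending after `a` time steps. -/
def controlEntry [Zero R] (n m d a : ℕ) (one : R) (z : ℕ → R) (i j : ℕ) : R :=
  -- The controller reads only columns before block `d`, so in the rows of the blocks `d` and `d + 1
  -- + a` they never meet the diagonal. Each entry is therefore one datum, `one` or zero, which
  -- keeps the error estimate simple.
  if n ≤ i ∧ ((i - n) / m = d ∨ (i - n) / m = d + 1 + a) ∧ j < n + d * m then
    z (n * n + (n * m + ((i - n) % m * (n + d * m) + j)))
  else if j = i ∧ ¬ (n ≤ i ∧ (i - n) / m = d) then one else 0

/-- The structured indices of the lifted state. -/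
def liftEquiv (n m d : ℕ) : Fin n ⊕ (Fin (2 * (d + 1)) × Fin m) ≃ Fin (liftDim n m d) :=
  (Equiv.sumCongr (Equiv.refl _) finProdFinEquiv).trans finSumFinEquiv

theorem liftEquiv_inl {n m d : ℕ} (i : Fin n) : (liftEquiv n m d (Sum.inl i) : ℕ) = i := rfl

theorem liftEquiv_inr {n m d : ℕ} (q : Fin (2 * (d + 1))) (r : Fin m) :
    (liftEquiv n m d (Sum.inr (q, r)) : ℕ) = n + (r + m * q) := rfl

theorem blockIndex_div {n m : ℕ} (q : ℕ) (r : Fin m) : (n + (r + m * q) - n) / m = q := by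
  have hm : 0 < m := r.pos
  rw [Nat.add_sub_cancel_left, Nat.add_mul_div_left _ _ hm, Nat.div_eq_of_lt r.2, Nat.zero_add]

theorem blockIndex_mod {n m : ℕ} (q : ℕ) (r : Fin m) : (n + (r + m * q) - n) % m = r := by
  rw [Nat.add_sub_cancel_left, Nat.add_mul_mod_self_left, Nat.mod_eq_of_lt r.2]

theorem blockIndex_inj {m : ℕ} {q q' : ℕ} {r r' : Fin m} :
    (r : ℕ) + m * q = r' + m * q' ↔ q = q' ∧ r = r' := by
  constructor
  · intro h
    have h1 := blockIndex_div (n := 0) q r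
    have h2 := blockIndex_mod (n := 0) q r
    rw [h, blockIndex_div] at h1
    rw [h, blockIndex_mod] at h2
    exact ⟨h1.symm, Fin.ext h2.symm⟩
  · rintro ⟨rfl, rfl⟩; rfl

theorem blockIndex_lt_iff {m : ℕ} {q d : ℕ} {r : Fin m} : (r : ℕ) + m * q < d * m ↔ q < d := by
  have hm : 0 < m := r.pos
  rw [← Nat.div_lt_iff_lt_mul hm, Nat.add_mul_div_left _ _ hm, Nat.div_eq_of_lt r.2, Nat.zero_add]

/-- The plant coordinates of a lifted state. -/
def liftPlant {n m d : ℕ} (y : Fin (liftDim n m d) → ℝ) (i : Fin n) : ℝ :=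
  y (liftEquiv n m d (Sum.inl i))

/-- The blocks of a lifted state. -/
def liftBlock {n m d : ℕ} (y : Fin (liftDim n m d) → ℝ) (q : ℕ) (r : Fin m) : ℝ :=
  if h : q < 2 * (d + 1) then y (liftEquiv n m d (Sum.inr (⟨q, h⟩, r))) else 0

theorem liftBlock_fin {n m d : ℕ} (y : Fin (liftDim n m d) → ℝ) (q : Fin (2 * (d + 1)))
    (r : Fin m) : y (liftEquiv n m d (Sum.inr (q, r))) = liftBlock y q r := by
  rw [liftBlock, dif_pos q.2]

theorem lift_ext {n m d : ℕ} {y y' : Fin (liftDim n m d) → ℝ} (h1 : liftPlant y = liftPlant y')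
    (h2 : ∀ q < 2 * (d + 1), liftBlock y q = liftBlock y' q) : y = y' := by
  funext i
  obtain ⟨i, rfl⟩ := (liftEquiv n m d).surjective i
  rcases i with i | ⟨q, r⟩
  · exact congrFun h1 i
  · rw [liftBlock_fin y, liftBlock_fin y', h2 q q.2]

theorem lift_sum {n m d : ℕ} (f : Fin (liftDim n m d) → ℝ) :
    ∑ j, f j = ∑ j : Fin n, liftPlant f j +
      ∑ q ∈ Finset.range (2 * (d + 1)), ∑ r : Fin m, liftBlock f q r := by
  rw [← (liftEquiv n m d).sum_comp, Fintype.sum_sum_type, Fintype.sum_prod_type,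
    ← Fin.sum_univ_eq_sum_range (fun q => ∑ r : Fin m, liftBlock f q r)]
  congr 1
  exact Finset.sum_congr rfl fun q _ => Finset.sum_congr rfl fun r _ => liftBlock_fin f q r

theorem norm_lift_le {n m d : ℕ} (y : Fin (liftDim n m d) → ℝ) {c : ℝ} (hc : 0 ≤ c)
    (h1 : ∀ i, |liftPlant y i| ≤ c) (h2 : ∀ q < 2 * (d + 1), ∀ r, |liftBlock y q r| ≤ c) :
    ‖y‖ ≤ c := by
  refine (pi_norm_le_iff_of_nonneg hc).mpr fun i => ?_
  obtain ⟨i, rfl⟩ := (liftEquiv n m d).surjective i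
  rcases i with i | ⟨q, r⟩
  · exact h1 i
  · rw [liftBlock_fin y]; exact h2 q q.2 r

/-- The matrix with the entries `plantEntry`. -/
def plantMatrix [Zero R] (n m d : ℕ) (one : R) (z : ℕ → R) :
    Matrix (Fin (liftDim n m d)) (Fin (liftDim n m d)) R :=
  Matrix.of fun i j => plantEntry n m d one z i j

/-- The matrix with the entries `controlEntry`. -/
def controlMatrix [Zero R] (n m d a : ℕ) (one : R) (z : ℕ → R) :
    Matrix (Fin (liftDim n m d)) (Fin (liftDim n m d)) R :=
  Matrix.of fun i j => controlEntry n m d a one z i j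

variable {n m d : ℕ} (z : ℕ → ℝ) (y : Fin (liftDim n m d) → ℝ)

theorem liftPlant_plantMatrix (i : Fin n) :
    liftPlant (plantMatrix n m d 1 z *ᵥ y) i =
      ∑ j : Fin n, z (i * n + j) * liftPlant y j +
        ∑ r : Fin m, z (n * n + (i * m + r)) * liftBlock y (d + 1) r := by
  rw [liftPlant, Matrix.mulVec, dotProduct, lift_sum]
  congr 1
  · simp [liftPlant, plantMatrix, plantEntry, liftEquiv_inl]
  · rw [Finset.sum_eq_single_of_mem (d + 1) (by simp)]
    · refine Finset.sum_congr rfl fun r _ => ?_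
      have h : d + 1 < 2 * (d + 1) := by omega
      simp only [liftBlock, dif_pos h, plantMatrix, Matrix.of_apply, plantEntry, liftEquiv_inl,
        liftEquiv_inr, blockIndex_div, blockIndex_mod]
      simp
    · intro q hq hqd
      refine Finset.sum_eq_zero fun r _ => ?_
      have h : q < 2 * (d + 1) := Finset.mem_range.mp hq
      simp only [liftBlock, dif_pos h, plantMatrix, Matrix.of_apply, plantEntry, liftEquiv_inl,
        liftEquiv_inr, blockIndex_div, blockIndex_mod]
      simp [hqd]

theorem liftBlock_plantMatrix {q : ℕ} (hq : q < 2 * (d + 1)) (r : Fin m) :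
    liftBlock (plantMatrix n m d 1 z *ᵥ y) q r = if q = d then 0 else liftBlock y (q + 1) r := by
  rw [liftBlock, dif_pos hq, Matrix.mulVec, dotProduct]
  simp only [plantMatrix, Matrix.of_apply, plantEntry, liftEquiv_inr, blockIndex_div]
  split_ifs with h1 h2 h2
  · omega
  · omega
  · simp [h2]
  · rw [lift_sum]
    have e1 : ∑ j : Fin n, liftPlant (d := d) (m := m) (fun x => (if q ≠ d ∧ (x : ℕ) = n + (r + m * q) + m
        then (1 : ℝ) else 0) * y x) j = 0 := by
      refine Finset.sum_eq_zero fun j _ => ?_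
      have := j.2
      rw [liftPlant, liftEquiv_inl, if_neg (by omega), zero_mul]
    rw [e1, zero_add]
    have e2 : ∀ q' ∈ Finset.range (2 * (d + 1)), ∀ r' : Fin m,
        liftBlock (n := n) (fun x => (if q ≠ d ∧ (x : ℕ) = n + (r + m * q) + m
        then (1 : ℝ) else 0) * y x) q' r' = if q' = q + 1 ∧ r' = r then liftBlock y q' r' else 0 := by
      intro q' hq' r'
      have h : q' < 2 * (d + 1) := Finset.mem_range.mp hq'
      have hiff : n + (r' + m * q') = n + ((r : ℕ) + m * q) + m ↔ q' = q + 1 ∧ r' = r := by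
        rw [← blockIndex_inj, Nat.mul_add, Nat.mul_one]; omega
      simp only [liftBlock, dif_pos h, liftEquiv_inr, hiff, ne_eq, h2, not_false_eq_true, true_and]
      split_ifs <;> simp
    rw [Finset.sum_congr rfl fun q' hq' => Finset.sum_congr rfl fun r' _ => e2 q' hq' r']
    by_cases h3 : q + 1 < 2 * (d + 1)
    · rw [Finset.sum_eq_single_of_mem (q + 1) (Finset.mem_range.mpr h3)]
      · simp
      · intro q' _ hne
        simp [hne]
    · rw [liftBlock, dif_neg h3]
      refine Finset.sum_eq_zero fun q' hq' => ?_
      have := Finset.mem_range.mp hq'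
      have : q' ≠ q + 1 := by omega
      simp [this]

/-- The controller output computed from a lifted state. -/
def liftOutput (z : ℕ → ℝ) (y : Fin (liftDim n m d) → ℝ) (r : Fin m) : ℝ :=
  ∑ j : Fin n, z (n * n + (n * m + (r * (n + d * m) + j))) * liftPlant y j +
    ∑ q ∈ Finset.range d, ∑ j : Fin m,
      z (n * n + (n * m + (r * (n + d * m) + (n + (j + m * q))))) * liftBlock y q j

theorem liftPlant_controlMatrix (a : ℕ) (i : Fin n) :
    liftPlant (controlMatrix n m d a 1 z *ᵥ y) i = liftPlant y i := by
  have hi := i.2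
  rw [liftPlant, liftPlant, Matrix.mulVec, dotProduct]
  rw [Finset.sum_eq_single_of_mem (liftEquiv n m d (Sum.inl i)) (Finset.mem_univ _)]
  · simp [controlMatrix, controlEntry, liftEquiv_inl]
  · intro j _ hj
    have : (j : ℕ) ≠ i := fun h => hj (Fin.ext h)
    simp [controlMatrix, controlEntry, liftEquiv_inl, this]

theorem liftBlock_controlMatrix (a : ℕ) {q : ℕ} (hq : q < 2 * (d + 1)) (r : Fin m) :
    liftBlock (controlMatrix n m d a 1 z *ᵥ y) q r = (if q = d then 0 else liftBlock y q r) +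
      if q = d ∨ q = d + 1 + a then liftOutput z y r else 0 := by
  rw [liftBlock, dif_pos hq, Matrix.mulVec, dotProduct]
  set i := liftEquiv n m d (Sum.inr (⟨q, hq⟩, r)) with hi
  have hiv : (i : ℕ) = n + (r + m * q) := rfl
  have hsplit : ∀ j : Fin (liftDim n m d), controlMatrix n m d a 1 z i j * y j =
      (if j = i then (if q = d then 0 else y j) else 0) + if q = d ∨ q = d + 1 + a then
        (if (j : ℕ) < n + d * m then z (n * n + (n * m + (r * (n + d * m) + j))) * y j else 0)
        else 0 := by
    intro j
    simp only [controlMatrix, Matrix.of_apply, controlEntry, hiv, blockIndex_div, blockIndex_mod,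
      Nat.le_add_right, true_and]
    by_cases hK : q = d ∨ q = d + 1 + a
    · by_cases hj : (j : ℕ) < n + d * m
      · have hne : ¬ j = i := by
          rintro rfl
          rw [hiv, Nat.add_lt_add_iff_left, blockIndex_lt_iff] at hj
          omega
        rw [if_pos ⟨hK, hj⟩, if_neg hne, if_pos hK, if_pos hj, zero_add]
      · rw [if_neg (by tauto), if_pos hK, if_neg hj, add_zero]
        have : (j : ℕ) = n + (r + m * q) ↔ j = i := by rw [← hiv, Fin.ext_iff]
        by_cases h1 : j = i <;> by_cases h2 : q = d <;> simp [this, h1, h2, hiv]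
    · rw [if_neg (by tauto), if_neg hK, add_zero]
      have : (j : ℕ) = n + (r + m * q) ↔ j = i := by rw [← hiv, Fin.ext_iff]
      by_cases h1 : j = i <;> by_cases h2 : q = d <;> simp [this, h1, h2, hiv]
  rw [Finset.sum_congr rfl fun j _ => hsplit j, Finset.sum_add_distrib, Finset.sum_ite_eq',
    if_pos (Finset.mem_univ _), hi, liftBlock_fin y]
  congr 1
  by_cases hK : q = d ∨ q = d + 1 + a
  · simp only [if_pos hK]
    rw [lift_sum, liftOutput]
    congr 1
    · refine Finset.sum_congr rfl fun j _ => ?_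
      rw [liftPlant, liftEquiv_inl, if_pos (by omega), liftPlant]
    · rw [← Finset.sum_subset (Finset.range_mono (show d ≤ 2 * (d + 1) by omega))]
      · refine Finset.sum_congr rfl fun q' hq' => Finset.sum_congr rfl fun r' _ => ?_
        have h1 := Finset.mem_range.mp hq'
        have h2 : q' < 2 * (d + 1) := by omega
        rw [liftBlock, dif_pos h2, liftEquiv_inr, liftBlock, dif_pos h2, if_pos]
        rw [Nat.add_lt_add_iff_left, blockIndex_lt_iff]
        exact h1
      · intro q' hq' hq''
        refine Finset.sum_eq_zero fun r' _ => ?_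
        have h2 := Finset.mem_range.mp hq'
        rw [liftBlock, dif_pos h2, liftEquiv_inr, if_neg]
        rw [Nat.add_lt_add_iff_left, blockIndex_lt_iff]
        simpa using hq''
  · simp [hK]

end Lift

/-! ### Location of the entries of `A`, `B`, `K` in the real data -/

namespace SwitchedDelay

variable {n m : ℕ} (S : SwitchedDelay n m) (K : S.Controller)

theorem realData_A (i j : Fin n) : (S.realData K).getD (i * n + j) 0 = S.A i j := by
  have h := Nat.mul_lt_mul_of_lt_of_le i.2 (le_refl n) i.pos
  rw [realData, List.getD_append, List.getD_flatten_ofFn (c := n) _ (by simp) _ j.2]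
  · simp
  · rw [List.length_flatten_ofFn (c := n) _ (by simp)]
    calc _ < i * n + n := by omega
      _ = (i + 1) * n := by ring
      _ ≤ n * n := Nat.mul_le_mul_right _ i.2

theorem realData_B (i : Fin n) (j : Fin m) :
    (S.realData K).getD (n * n + (i * m + j)) 0 = S.B i j := by
  have h1 : (List.ofFn fun i => List.ofFn fun j => S.A i j).flatten.length = n * n :=
    List.length_flatten_ofFn (c := n) _ (by simp)
  rw [realData, List.getD_append_right _ _ _ _ (by omega), h1, Nat.add_sub_cancel_left,
    List.getD_append, List.getD_flatten_ofFn (c := m) _ (by simp) _ j.2]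
  · simp
  · rw [List.length_flatten_ofFn (c := m) _ (by simp)]
    calc _ < i * m + m := by omega
      _ = (i + 1) * m := by ring
      _ ≤ n * m := Nat.mul_le_mul_right _ i.2

theorem realData_K {c : ℕ} (i : Fin m) (hc : c < n + S.dmax * m) :
    (S.realData K).getD (n * n + (n * m + (i * (n + S.dmax * m) + c))) 0 =
      ((List.ofFn fun j => K i (Sum.inl j)) ++
        (List.ofFn fun d => List.ofFn fun j => K i (Sum.inr (d, j))).flatten).getD c 0 := by
  have h1 : (List.ofFn fun i => List.ofFn fun j => S.A i j).flatten.length = n * n :=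
    List.length_flatten_ofFn (c := n) _ (by simp)
  have h2 : (List.ofFn fun i => List.ofFn fun j => S.B i j).flatten.length = n * m :=
    List.length_flatten_ofFn (c := m) _ (by simp)
  rw [realData, List.getD_append_right _ _ _ _ (by omega), h1, Nat.add_sub_cancel_left,
    List.getD_append_right _ _ _ _ (by omega), h2, Nat.add_sub_cancel_left,
    List.getD_flatten_ofFn (c := n + S.dmax * m) _ _ _ hc]
  intro i
  rw [List.length_append, List.length_ofFn, List.length_flatten_ofFn (c := m) _ (by simp)]

theorem realData_K_inl (i : Fin m) (j : Fin n) :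
    (S.realData K).getD (n * n + (n * m + (i * (n + S.dmax * m) + j))) 0 = K i (Sum.inl j) := by
  rw [realData_K _ _ _ (by omega), List.getD_append _ _ _ _ (by simp)]
  simp

theorem realData_K_inr (i : Fin m) (q : Fin S.dmax) (j : Fin m) :
    (S.realData K).getD (n * n + (n * m + (i * (n + S.dmax * m) + (n + (j + m * q))))) 0 =
      K i (Sum.inr (q, j)) := by
  rw [realData_K _ _ _ (by rw [Nat.add_lt_add_iff_left, blockIndex_lt_iff]; exact q.2),
    List.getD_append_right _ _ _ _ (by simp), List.length_ofFn, Nat.add_sub_cancel_left,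
    add_comm (j : ℕ), mul_comm m, List.getD_flatten_ofFn (c := m) _ (by simp) _ j.2]
  simp

end SwitchedDelay

/-! ### Runs of the closed loop as trajectories of the lifted system -/

namespace SwitchedDelay

variable {n m : ℕ} (S : SwitchedDelay n m) (K : S.Controller)

/-- The entry of the real data at a given position. -/
noncomputable def dataAt (k : ℕ) : ℝ := (S.realData K).getD k 0

/-- The one-step matrix of the lifted closed loop when the delay of the current output is `a`. -/
noncomputable def liftMatrix (a : ℕ) :
    Matrix (Fin (liftDim n m S.dmax)) (Fin (liftDim n m S.dmax)) ℝ :=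
  -- The controller factor acts first, so that an output with delay `0` reaches the plant within the
  -- same step.
  plantMatrix n m S.dmax 1 (S.dataAt K) * controlMatrix n m S.dmax a 1 (S.dataAt K)

/-- The part of a lifted state that the controller reads. -/
def liftExt (y : Fin (liftDim n m S.dmax) → ℝ) : S.ExtIdx → ℝ :=
  Sum.elim (liftPlant y) (fun p => liftBlock y p.1 p.2)

theorem liftOutput_eq (y : Fin (liftDim n m S.dmax) → ℝ) :
    liftOutput (S.dataAt K) y = K *ᵥ S.liftExt y := by
  funext r
  rw [liftOutput, Matrix.mulVec, dotProduct, Fintype.sum_sum_type, Fintype.sum_prod_type,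
    ← Fin.sum_univ_eq_sum_range (fun q => ∑ j : Fin m, S.dataAt K (n * n + (n * m +
      (r * (n + S.dmax * m) + (n + (j + m * q))))) * liftBlock y q j)]
  congr 1
  · exact Finset.sum_congr rfl fun j _ => by rw [dataAt, realData_K_inl]; rfl
  · exact Finset.sum_congr rfl fun q _ => Finset.sum_congr rfl fun j _ => by
      rw [dataAt, realData_K_inr]; rfl

variable {S K}

theorem liftPlant_liftMatrix (a : ℕ) (y : Fin (liftDim n m S.dmax) → ℝ) :
    liftPlant (S.liftMatrix K a *ᵥ y) = S.A *ᵥ liftPlant y +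
      S.B *ᵥ (liftBlock y (S.dmax + 1) + if a = 0 then K *ᵥ S.liftExt y else 0) := by
  funext i
  rw [liftMatrix, ← Matrix.mulVec_mulVec, liftPlant_plantMatrix]
  congr 1
  · exact Finset.sum_congr rfl fun j _ => by
      rw [liftPlant_controlMatrix, dataAt, realData_A]
  · refine Finset.sum_congr rfl fun r _ => ?_
    rw [dataAt, realData_B, liftBlock_controlMatrix _ _ _ (by omega), liftOutput_eq]
    congr 1
    rw [if_neg (by omega), Pi.add_apply]
    congr 1
    by_cases ha : a = 0
    · simp [ha]
    · rw [if_neg (by omega), if_neg ha]; rfl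

theorem liftBlock_liftMatrix (a : ℕ) (y : Fin (liftDim n m S.dmax) → ℝ) {q : ℕ}
    (hq : q + 1 < 2 * (S.dmax + 1)) (hqd : q ≠ S.dmax) :
    liftBlock (S.liftMatrix K a *ᵥ y) q = (if q + 1 = S.dmax then 0 else liftBlock y (q + 1)) +
      if q + 1 = S.dmax ∨ q + 1 = S.dmax + 1 + a then K *ᵥ S.liftExt y else 0 := by
  funext r
  rw [liftMatrix, ← Matrix.mulVec_mulVec, liftBlock_plantMatrix _ _ (by omega), if_neg hqd,
    liftBlock_controlMatrix _ _ _ hq, liftOutput_eq, Pi.add_apply]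
  congr 1 <;> split_ifs <;> rfl

theorem liftBlock_liftMatrix_dmax (a : ℕ) (y : Fin (liftDim n m S.dmax) → ℝ) :
    liftBlock (S.liftMatrix K a *ᵥ y) S.dmax = 0 := by
  funext r
  rw [liftMatrix, ← Matrix.mulVec_mulVec, liftBlock_plantMatrix _ _ (by omega), if_pos rfl]
  rfl

theorem liftBlock_liftMatrix_last (a : ℕ) (y : Fin (liftDim n m S.dmax) → ℝ) :
    liftBlock (S.liftMatrix K a *ᵥ y) (2 * S.dmax + 1) = 0 := by
  funext r
  rw [liftMatrix, ← Matrix.mulVec_mulVec, liftBlock_plantMatrix _ _ (by omega), if_neg (by omega),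
    liftBlock, dif_neg (by omega)]
  rfl

theorem le_dmax {a : ℕ} (ha : a ∈ S.D) : a ≤ S.dmax := Finset.le_max' _ _ ha

variable (S) in
/-- The sum of the outputs computed before time `t` that arrive at time `T`. -/
noncomputable def pendingInput (σ : ℤ → ℕ) (v : ℤ → Fin m → ℝ) (t T : ℤ) : Fin m → ℝ :=
  ∑ s ∈ (Finset.Ico (t - S.dmax) t).filter (fun s : ℤ => s + (σ s : ℤ) = T), v s

theorem plantInput_eq_pendingInput_add (σ : ℤ → ℕ) (v : ℤ → Fin m → ℝ) (t : ℕ) :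
    S.plantInput σ v t = S.pendingInput σ v t t + if σ t = 0 then v t else 0 := by
  have h : Finset.Icc ((t : ℤ) - S.dmax) t = insert (t : ℤ) (Finset.Ico ((t : ℤ) - S.dmax) t) := by
    ext s; simp
  rw [plantInput, pendingInput, h, Finset.filter_insert]
  by_cases h0 : σ t = 0
  · rw [if_pos (by omega), Finset.sum_insert (by simp), add_comm, if_pos h0]
  · rw [if_neg (by omega), if_neg h0, add_zero]

theorem pendingInput_succ {σ : ℤ → ℕ} (hσ : ∀ s, σ s ∈ S.D) (v : ℤ → Fin m → ℝ) {t T : ℤ}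
    (hT : t < T) : S.pendingInput σ v (t + 1) T =
      S.pendingInput σ v t T + if t + σ t = T then v t else 0 := by
  -- The time leaving the window has an arrival time of at most `t < T`, so it does not contribute.
  have h : (Finset.Ico (t + 1 - S.dmax) (t + 1)).filter (fun s : ℤ => s + (σ s : ℤ) = T) =
      (insert t (Finset.Ico (t - S.dmax) t)).filter (fun s : ℤ => s + (σ s : ℤ) = T) := by
    ext s
    have := le_dmax (hσ s)
    simp
    omega
  rw [pendingInput, h, Finset.filter_insert, pendingInput]
  by_cases h0 : t + σ t = T
  · rw [if_pos h0, Finset.sum_insert (by simp), add_comm, if_pos h0]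
  · rw [if_neg h0, if_neg h0, add_zero]

theorem pendingInput_eq_zero {σ : ℤ → ℕ} (hσ : ∀ s, σ s ∈ S.D) (v : ℤ → Fin m → ℝ) {t T : ℤ}
    (hT : t + S.dmax ≤ T) : S.pendingInput σ v t T = 0 := by
  rw [pendingInput, Finset.filter_false_of_mem, Finset.sum_empty]
  intro s hs
  have := le_dmax (hσ s)
  have := Finset.mem_Ico.mp hs
  omega

variable (S) in
/-- The lifted state of a run. -/
noncomputable def liftRun (σ : ℤ → ℕ) (x : ℕ → Fin n → ℝ) (v : ℤ → Fin m → ℝ) (t : ℕ) :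
    Fin (liftDim n m S.dmax) → ℝ := fun i =>
  Sum.elim (x t) (fun p => (if (p.1 : ℕ) < S.dmax then v (t - S.dmax + (p.1 : ℕ)) else
    if (p.1 : ℕ) = S.dmax then 0 else
      S.pendingInput σ v t (t + ((p.1 : ℕ) - (S.dmax + 1)))) p.2)
    ((liftEquiv n m S.dmax).symm i)

section Run

variable {σ : ℤ → ℕ} {x : ℕ → Fin n → ℝ} {v : ℤ → Fin m → ℝ}

theorem liftPlant_liftRun (t : ℕ) : liftPlant (S.liftRun σ x v t) = x t := by
  funext i
  simp [liftPlant, liftRun]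

theorem liftBlock_liftRun (t : ℕ) {q : ℕ} (hq : q < 2 * (S.dmax + 1)) :
    liftBlock (S.liftRun σ x v t) q = if q < S.dmax then v (t - S.dmax + q) else
      if q = S.dmax then 0 else S.pendingInput σ v t (t + (q - (S.dmax + 1))) := by
  funext r
  simp [liftBlock, liftRun, hq]

theorem liftExt_liftRun (t : ℕ) : S.liftExt (S.liftRun σ x v t) = S.extState x v t := by
  rw [liftExt, extState, liftPlant_liftRun]
  congr 1
  funext p
  have := p.1.2
  rw [liftBlock_liftRun t (by omega), if_pos this]

theorem IsRun.liftRun_succ (h : S.IsRun K σ x v) (t : ℕ) :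
    S.liftRun σ x v (t + 1) = S.liftMatrix K (σ t) *ᵥ S.liftRun σ x v t := by
  refine lift_ext ?_ fun q hq => ?_
  · rw [liftPlant_liftRun, liftPlant_liftMatrix, h.plant, liftPlant_liftRun,
      plantInput_eq_pendingInput_add, liftBlock_liftRun t (by omega), liftExt_liftRun,
      ← h.control, if_neg (show ¬ S.dmax + 1 < S.dmax by omega),
      if_neg (show ¬ S.dmax + 1 = S.dmax by omega)]
    simp
  · rw [liftBlock_liftRun _ hq]
    rcases lt_trichotomy q S.dmax with hqd | rfl | hqd
    · rw [if_pos hqd, liftBlock_liftMatrix _ _ (by omega) hqd.ne, liftExt_liftRun, ← h.control]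
      by_cases h1 : q + 1 = S.dmax
      · rw [if_pos h1, if_pos (Or.inl h1), zero_add]
        congr 1
        push_cast
        omega
      · rw [if_neg h1, if_neg (by omega), liftBlock_liftRun _ (by omega), if_pos (by omega), add_zero]
        congr 1
        push_cast
        omega
    · rw [liftBlock_liftMatrix_dmax]
      simp
    · rw [if_neg (by omega), if_neg (by omega)]
      by_cases h1 : q = 2 * S.dmax + 1
      · rw [h1, liftBlock_liftMatrix_last]
        exact pendingInput_eq_zero h.signal _ (by push_cast; omega)
      · rw [liftBlock_liftMatrix _ _ (by omega) hqd.ne', liftExt_liftRun, ← h.control,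
          if_neg (by omega), liftBlock_liftRun _ (by omega), if_neg (by omega), if_neg (by omega)]
        have e : ((t + 1 : ℕ) : ℤ) + (q - (S.dmax + 1)) = t + ((q + 1 : ℕ) - (S.dmax + 1)) := by
          push_cast; omega
        rw [e, Nat.cast_succ t, pendingInput_succ h.signal _ (by push_cast; omega)]
        congr 1
        refine if_congr ?_ rfl rfl
        push_cast
        omega

theorem norm_le_norm_extState (t : ℕ) {s : ℤ} (h1 : t - S.dmax ≤ s) (h2 : s < t) :
    ‖v s‖ ≤ ‖S.extState x v t‖ := by
  refine (pi_norm_le_iff_of_nonneg (norm_nonneg _)).mpr fun j => ?_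
  have := norm_le_pi_norm (S.extState x v t) (Sum.inr (⟨(s - (t - S.dmax)).toNat, by omega⟩, j))
  rw [extState, Sum.elim_inr, Int.toNat_of_nonneg (by omega), ← extState] at this
  rwa [show (t : ℤ) - S.dmax + (s - (t - S.dmax)) = s by ring] at this

/-- A pending input is a sum of at most `dmax` stored outputs, each of which is part of the extended
state. -/
theorem norm_liftRun_le (t : ℕ) :
    ‖S.liftRun σ x v t‖ ≤ (S.dmax + 1) * ‖S.extState x v t‖ := by
  have h0 := norm_nonneg (S.extState x v t)
  have h1 : ‖S.extState x v t‖ ≤ (S.dmax + 1) * ‖S.extState x v t‖ := by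
    have : (0 : ℝ) ≤ S.dmax := Nat.cast_nonneg _
    nlinarith
  refine norm_lift_le _ (by positivity) (fun i => ?_) fun q hq r => ?_
  · rw [liftPlant_liftRun]
    exact (norm_le_pi_norm (S.extState x v t) (Sum.inl i)).trans h1
  · rw [liftBlock_liftRun _ hq, ← Real.norm_eq_abs]
    refine (norm_le_pi_norm _ r).trans ?_
    split_ifs with h2 h3
    · exact (norm_le_norm_extState t (by omega) (by omega)).trans h1
    · rw [norm_zero]; positivity
    · rw [pendingInput]
      refine (norm_sum_le_of_le (f := fun s => v s) (n := fun _ => ‖S.extState x v t‖) _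
        fun s hs => ?_).trans ?_
      · have := Finset.mem_Ico.mp (Finset.mem_filter.mp hs).1
        exact norm_le_norm_extState t this.1 this.2
      · rw [Finset.sum_const, nsmul_eq_mul]
        gcongr
        refine (Nat.cast_le.mpr (Finset.card_filter_le _ _)).trans ?_
        simp

end Run

variable (S K) in
/-- The switched linear system on the lifted state space. -/
noncomputable def liftFamily (a : S.D) :
    Matrix (Fin (liftDim n m S.dmax)) (Fin (liftDim n m S.dmax)) ℝ := S.liftMatrix K a

theorem norm_liftExt_le (y : Fin (liftDim n m S.dmax) → ℝ) : ‖S.liftExt y‖ ≤ ‖y‖ := by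
  refine (pi_norm_le_iff_of_nonneg (norm_nonneg _)).mpr fun i => ?_
  rcases i with i | ⟨q, r⟩
  · exact norm_le_pi_norm y _
  · have := q.2
    rw [liftExt, Sum.elim_inr, liftBlock, dif_pos (by omega)]
    exact norm_le_pi_norm y _

theorem growthAtMost_of_productsBounded {s : ℝ}
    (h : ProductsBounded (S.liftFamily K) s) : S.GrowthAtMost K s := by
  obtain ⟨C, hC⟩ := h
  intro ξ
  -- The initial lifted state depends on `σ` at negative times, but its norm is at most `(dmax + 1)
  -- * ‖ξ‖`; this makes the constant uniform in `σ`.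
  refine ⟨C * ((S.dmax + 1) * ‖ξ‖), fun σ x v hrun hξ t => ?_⟩
  have hy : ∃ w : List S.D, w.length = t ∧
      S.liftRun σ x v t = (w.map (S.liftFamily K)).prod *ᵥ S.liftRun σ x v 0 := by
    clear hC
    induction t with
    | zero => exact ⟨[], rfl, by simp⟩
    | succ t ih =>
      obtain ⟨w, hw, hwt⟩ := ih
      refine ⟨⟨σ t, hrun.signal t⟩ :: w, by simp [hw], ?_⟩
      rw [hrun.liftRun_succ, hwt, List.map_cons, List.prod_cons, ← Matrix.mulVec_mulVec]
      rfl
  obtain ⟨w, hw, hwt⟩ := hy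
  have hCw := hC w
  have h0 := norm_liftRun_le (S := S) (σ := σ) (x := x) (v := v) 0
  rw [hξ] at h0
  calc ‖S.extState x v t‖ ≤ ‖S.liftRun σ x v t‖ := by
        rw [← liftExt_liftRun (σ := σ)]; exact norm_liftExt_le _
    _ ≤ ‖(w.map (S.liftFamily K)).prod‖ * ‖S.liftRun σ x v 0‖ := by
        rw [hwt]; exact Matrix.linfty_opNorm_mulVec _ _
    _ ≤ C * s ^ t * ((S.dmax + 1) * ‖ξ‖) := by
        rw [hw] at hCw
        exact mul_le_mul hCw h0 (norm_nonneg _) ((norm_nonneg _).trans hCw)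
    _ = _ := by ring

/-! ### From lifted trajectories back to runs -/

section Trajectory

variable {a : ℕ → ℕ} {y : ℕ → Fin (liftDim n m S.dmax) → ℝ}

theorem liftBlock_trajectory_output (hy : ∀ t, y (t + 1) = S.liftMatrix K (a t) *ᵥ y t) (t i q : ℕ)
    (h : q + 1 + i = S.dmax) : liftBlock (y (t + 1 + i)) q = K *ᵥ S.liftExt (y t) := by
  induction i generalizing q with
  | zero =>
    rw [Nat.add_zero, hy, liftBlock_liftMatrix _ _ (by omega) (by omega), if_pos (by omega),
      if_pos (by omega), zero_add]
  | succ i ih =>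
    rw [← add_assoc, hy, liftBlock_liftMatrix _ _ (by omega) (by omega), if_neg (by omega),
      if_neg (by omega), add_zero, ih _ (by omega)]

/-- The last pending block is empty after each step, so after enough steps the pending blocks
contain only outputs computed along the trajectory. The output of `c + 1` steps ago lies in the
block `dmax + 1 + δ` exactly if its delay was `δ + 1 + c`. -/
theorem liftBlock_trajectory_pending (hy : ∀ t, y (t + 1) = S.liftMatrix K (a t) *ᵥ y t)
    (i δ t : ℕ) (h : δ + i = S.dmax) (ht : i < t) :
    liftBlock (y t) (S.dmax + 1 + δ) =
      ∑ c ∈ Finset.range i, if a (t - 1 - c) = δ + 1 + c then K *ᵥ S.liftExt (y (t - 1 - c)) else 0 := by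
  induction i generalizing δ t with
  | zero =>
    obtain ⟨t, rfl⟩ := Nat.exists_eq_succ_of_ne_zero (show t ≠ 0 by omega)
    rw [Nat.succ_eq_add_one, hy, show S.dmax + 1 + δ = 2 * S.dmax + 1 by omega,
      liftBlock_liftMatrix_last]
    simp
  | succ i ih =>
    obtain ⟨t, rfl⟩ := Nat.exists_eq_succ_of_ne_zero (show t ≠ 0 by omega)
    rw [Nat.succ_eq_add_one, hy, liftBlock_liftMatrix _ _ (by omega) (by omega), if_neg (by omega),
      show S.dmax + 1 + δ + 1 = S.dmax + 1 + (δ + 1) by omega, ih _ _ (by omega) (by omega),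
      Finset.sum_range_succ']
    congr 1
    · refine Finset.sum_congr rfl fun c _ => ?_
      rw [show t + 1 - 1 - (c + 1) = t - 1 - c by omega,
        show δ + 1 + (c + 1) = δ + 1 + 1 + c by omega]
    · refine if_congr ?_ rfl rfl
      simp
      omega

theorem plantInput_trajectory (hy : ∀ t, y (t + 1) = S.liftMatrix K (a t) *ᵥ y t) (t : ℕ) :
    S.plantInput (fun s => a (s + (S.dmax + 1)).toNat)
        (fun s => K *ᵥ S.liftExt (y (s + (S.dmax + 1)).toNat)) t =
      liftBlock (y (t + (S.dmax + 1))) (S.dmax + 1) +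
        if a (t + (S.dmax + 1)) = 0 then K *ᵥ S.liftExt (y (t + (S.dmax + 1))) else 0 := by
  have h1 := liftBlock_trajectory_pending hy S.dmax 0 (t + (S.dmax + 1)) (by omega) (by omega)
  rw [Nat.add_zero] at h1
  rw [h1, plantInput, Finset.sum_filter]
  have h2 := Finset.sum_range_succ' (fun c => if a (t + (S.dmax + 1) - c) = c then
    K *ᵥ S.liftExt (y (t + (S.dmax + 1) - c)) else 0) S.dmax
  have h3 : ∀ c, t + (S.dmax + 1) - 1 - c = t + (S.dmax + 1) - (c + 1) := by omega
  simp only [h3, show ∀ c, 0 + 1 + c = c + 1 by omega]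
  rw [Nat.sub_zero] at h2
  rw [← h2]
  refine Finset.sum_bij' (fun s _ => (t - s).toNat) (fun c _ => (t : ℤ) - c) ?_ ?_ ?_ ?_ ?_
  · intro s hs
    have := Finset.mem_Icc.mp hs
    simp; omega
  · intro c hc
    have := Finset.mem_range.mp hc
    simp; omega
  · intro s hs
    have := Finset.mem_Icc.mp hs
    simp; omega
  · intro c hc
    simp
  · intro s hs
    have := Finset.mem_Icc.mp hs
    have e : (s + (S.dmax + 1)).toNat = t + (S.dmax + 1) - (t - s).toNat := by omega
    simp only [e]
    refine if_congr ?_ rfl rfl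
    omega

/-- In an arbitrary lifted state the pending inputs may be inconsistent with the stored outputs, but
`dmax + 1` steps flush everything inherited. The run starts at that time of the trajectory, and the
earlier steps supply its outputs and delays at negative times. The truncation by `toNat` only
affects times before `-dmax - 1`, which are never used. -/
theorem exists_isRun_of_trajectory (ha : ∀ t, a t ∈ S.D)
    (hy : ∀ t, y (t + 1) = S.liftMatrix K (a t) *ᵥ y t) :
    ∃ (σ : ℤ → ℕ) (x : ℕ → Fin n → ℝ) (v : ℤ → Fin m → ℝ), S.IsRun K σ x v ∧
      ∀ t, S.extState x v t = S.liftExt (y (t + (S.dmax + 1))) := by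
  have hext : ∀ t, S.extState (fun t => liftPlant (y (t + (S.dmax + 1))))
      (fun s => K *ᵥ S.liftExt (y (s + (S.dmax + 1)).toNat)) t =
        S.liftExt (y (t + (S.dmax + 1))) := by
    intro t
    rw [extState, liftExt]
    congr 1
    funext p
    have hp := p.1.2
    have h1 := liftBlock_trajectory_output hy (t + 1 + p.1) (S.dmax - 1 - p.1) p.1 (by omega)
    rw [show t + 1 + p.1 + 1 + (S.dmax - 1 - p.1) = t + (S.dmax + 1) by omega] at h1
    rw [h1]
    congr 4
    omega
  refine ⟨fun s => a (s + (S.dmax + 1)).toNat, fun t => liftPlant (y (t + (S.dmax + 1))),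
    fun s => K *ᵥ S.liftExt (y (s + (S.dmax + 1)).toNat), ⟨fun t => ha _, fun t => ?_, fun t => ?_⟩,
    hext⟩
  · rw [plantInput_trajectory hy, show t + 1 + (S.dmax + 1) = t + (S.dmax + 1) + 1 by omega, hy,
      liftPlant_liftMatrix]
  · rw [hext]
    congr 3

/-- Growth of the lifted state cannot hide in the pending blocks: after the flush they are sums of
at most `dmax` outputs that the controller still reads. -/
theorem norm_trajectory_le (hy : ∀ t, y (t + 1) = S.liftMatrix K (a t) *ᵥ y t) (t : ℕ) :
    ‖y (t + (S.dmax + 1))‖ ≤ (S.dmax + 1) * ‖S.liftExt (y (t + (S.dmax + 1)))‖ := by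
  set Y := y (t + (S.dmax + 1)) with hY
  have h0 := norm_nonneg (S.liftExt Y)
  have h1 : ‖S.liftExt Y‖ ≤ (S.dmax + 1) * ‖S.liftExt Y‖ := by
    have : (0 : ℝ) ≤ S.dmax := Nat.cast_nonneg _
    nlinarith
  have hb : ∀ q < S.dmax, ‖liftBlock Y q‖ ≤ ‖S.liftExt Y‖ := fun q hq =>
    (pi_norm_le_iff_of_nonneg h0).mpr fun r => norm_le_pi_norm (S.liftExt Y) (Sum.inr (⟨q, hq⟩, r))
  refine norm_lift_le _ (by positivity) (fun i => ?_) fun q hq r => ?_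
  · exact (norm_le_pi_norm (S.liftExt Y) (Sum.inl i)).trans h1
  · rw [← Real.norm_eq_abs]
    refine (norm_le_pi_norm _ r).trans ?_
    rcases lt_trichotomy q S.dmax with hqd | rfl | hqd
    · exact (hb q hqd).trans h1
    · rw [hY, ← add_assoc, hy, liftBlock_liftMatrix_dmax, norm_zero]
      positivity
    · obtain ⟨δ, rfl⟩ := Nat.exists_eq_add_of_le (Nat.succ_le_of_lt hqd)
      have h2 := liftBlock_trajectory_pending hy (S.dmax - δ) δ (t + (S.dmax + 1)) (by omega) (by omega)
      rw [← hY] at h2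
      rw [Nat.succ_eq_add_one, h2]
      refine (norm_sum_le_of_le (n := fun _ => ‖S.liftExt Y‖) _ fun c hc => ?_).trans ?_
      · have hc' := Finset.mem_range.mp hc
        split_ifs with h3
        · have h4 := liftBlock_trajectory_output hy (t + (S.dmax + 1) - 1 - c) c (S.dmax - 1 - c)
            (by omega)
          rw [show t + (S.dmax + 1) - 1 - c + 1 + c = t + (S.dmax + 1) by omega] at h4
          rw [← h4]
          exact hb _ (by omega)
        · rw [norm_zero]; exact h0
      · rw [Finset.sum_const, nsmul_eq_mul, Finset.card_range]
        gcongr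
        have : ((S.dmax - δ : ℕ) : ℝ) ≤ S.dmax := by exact_mod_cast Nat.sub_le _ _
        linarith

end Trajectory

/-! ### Rates of growth and boundedness of products -/

theorem growthAtLeast_of_not_productsBounded {s : ℝ} (hs : 0 < s)
    (h : ¬ ProductsBounded (S.liftFamily K) s) : S.GrowthAtLeast K s := by
  obtain ⟨a, y, hy0, hy, hgrow⟩ := exists_trajectory_of_not_productsBounded _ hs h
  have hy' : ∀ t, y (t + 1) = S.liftMatrix K (a t) *ᵥ y t := hy
  obtain ⟨σ, x, v, hrun, hext⟩ := exists_isRun_of_trajectory (fun t => (a t).2) hy'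
  have hpos : 0 < ‖y 0‖ := norm_pos_iff.mpr hy0
  refine ⟨σ, x, v, hrun, s ^ (S.dmax + 1) * ‖y 0‖ / (S.dmax + 1), by positivity, fun t => ?_⟩
  have h1 := norm_trajectory_le hy' t
  have h2 := hgrow (t + (S.dmax + 1))
  rw [hext, div_mul_eq_mul_div, div_le_iff₀ (by positivity)]
  calc s ^ (S.dmax + 1) * ‖y 0‖ * s ^ t = s ^ (t + (S.dmax + 1)) * ‖y 0‖ := by ring
    _ ≤ _ := h2.trans h1
    _ = _ := by ring

theorem GrowthAtLeast.mono {r s : ℝ} (hr : 0 ≤ r) (hrs : r ≤ s) (h : S.GrowthAtLeast K s) :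
    S.GrowthAtLeast K r := by
  obtain ⟨σ, x, v, hrun, C, hC, hb⟩ := h
  exact ⟨σ, x, v, hrun, C, hC, fun t => le_trans (by gcongr) (hb t)⟩

theorem GrowthAtMost.mono {r s : ℝ} (hr : 0 ≤ r) (hrs : r ≤ s) (h : S.GrowthAtMost K r) :
    S.GrowthAtMost K s := by
  intro ξ
  obtain ⟨C, hC⟩ := h ξ
  refine ⟨|C|, fun σ x v hrun h0 t => (hC σ x v hrun h0 t).trans ?_⟩
  have := le_abs_self C
  gcongr

theorem GrowthAtLeast.le_of_growthAtMost {r s : ℝ} (hr : 0 < r)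
    (hl : S.GrowthAtLeast K s) (hu : S.GrowthAtMost K r) : s ≤ r := by
  obtain ⟨σ, x, v, hrun, C, hC, hb⟩ := hl
  obtain ⟨C', hC'⟩ := hu (S.extState x v 0)
  refine le_of_forall_pow_le_mul_pow (C := C' / C) hr.le fun t => ?_
  rw [div_mul_eq_mul_div, le_div_iff₀ hC, mul_comm]
  exact (hb t).trans (hC' σ x v hrun rfl t)

theorem worstGrowthRate_le {r : ℝ} (hr : 0 < r) (h : S.GrowthAtMost K r) :
    S.worstGrowthRate K ≤ r :=
  csInf_le ⟨0, fun _ hx => hx.1.le⟩ ⟨hr, h⟩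

theorem worstGrowthRate_nonneg : 0 ≤ S.worstGrowthRate K :=
  Real.sInf_nonneg fun _ hx => hx.1.le

theorem le_worstGrowthRate {s : ℝ} (h : S.GrowthAtLeast K s) :
    s ≤ S.worstGrowthRate K := by
  obtain ⟨r, hr, hb⟩ := exists_productsBounded (S.liftFamily K)
  exact le_csInf ⟨r, hr, growthAtMost_of_productsBounded hb⟩ fun r hr =>
    h.le_of_growthAtMost hr.1 hr.2

end SwitchedDelay

/-! ### Perturbation of matrix products -/

section Perturbation

variable {κ : Type*} [Fintype κ] [DecidableEq κ]

theorem norm_one_matrix_le : ‖(1 : Matrix κ κ ℝ)‖ ≤ 1 :=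
  norm_le_of_mulVec_le _ zero_le_one fun y => by simp

theorem norm_list_prod_le {α : Type*} (X : α → Matrix κ κ ℝ) {b : ℝ} (w : List α)
    (h : ∀ a ∈ w, ‖X a‖ ≤ b) : ‖(w.map X).prod‖ ≤ b ^ w.length := by
  induction w with
  | nil => simpa using norm_one_matrix_le
  | cons a w ih =>
    have h1 := h a (by simp)
    rw [List.map_cons, List.prod_cons, List.length_cons, pow_succ']
    exact (norm_mul_le _ _).trans (mul_le_mul h1 (ih fun a ha => h a (by simp [ha]))
      (norm_nonneg _) ((norm_nonneg _).trans h1))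

theorem norm_prod_sub_prod_le {α : Type*} (X Y : α → Matrix κ κ ℝ) {b δ : ℝ} (hb : 1 ≤ b)
    (hδ : 0 ≤ δ) (w : List α) (hX : ∀ a ∈ w, ‖X a‖ ≤ b) (hY : ∀ a ∈ w, ‖Y a‖ ≤ b)
    (h : ∀ a ∈ w, ‖X a - Y a‖ ≤ δ) :
    ‖(w.map X).prod - (w.map Y).prod‖ ≤ w.length * δ * b ^ w.length := by
  induction w with
  | nil => simp
  | cons a w ih =>
    have hX' := norm_list_prod_le X w fun a ha => hX a (by simp [ha])
    have ih' := ih (fun a ha => hX a (by simp [ha])) (fun a ha => hY a (by simp [ha]))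
      fun a ha => h a (by simp [ha])
    simp only [List.map_cons, List.prod_cons, List.length_cons]
    have e : X a * (w.map X).prod - Y a * (w.map Y).prod =
        (X a - Y a) * (w.map X).prod + Y a * ((w.map X).prod - (w.map Y).prod) := by
      noncomm_ring
    rw [e]
    have hbw : b ^ w.length ≤ b ^ (w.length + 1) := pow_le_pow_right₀ hb (by omega)
    calc _ ≤ ‖X a - Y a‖ * ‖(w.map X).prod‖ + ‖Y a‖ * ‖(w.map X).prod - (w.map Y).prod‖ :=
          (norm_add_le _ _).trans (add_le_add (norm_mul_le _ _) (norm_mul_le _ _))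
      _ ≤ δ * b ^ w.length + b * (w.length * δ * b ^ w.length) := by
          gcongr
          · exact h a (by simp)
          · exact hY a (by simp)
      _ ≤ δ * b ^ (w.length + 1) + w.length * δ * b ^ (w.length + 1) := by
          have : b * (w.length * δ * b ^ w.length) = w.length * δ * b ^ (w.length + 1) := by ring
          rw [this]
          gcongr
      _ = _ := by push_cast; ring

theorem abs_trace_le_card_mul_norm (M : Matrix κ κ ℝ) : |M.trace| ≤ Fintype.card κ * ‖M‖ := by
  rw [Matrix.trace]
  refine (Finset.abs_sum_le_sum_abs _ _).trans ?_
  calc _ ≤ ∑ _i : κ, ‖M‖ := Finset.sum_le_sum fun i _ => norm_entry_le M i i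
    _ = _ := by simp

theorem norm_le_sum_abs (M : Matrix κ κ ℝ) : ‖M‖ ≤ ∑ i, ∑ j, |M i j| := by
  have h0 : 0 ≤ ∑ i, ∑ j, |M i j| := Finset.sum_nonneg fun _ _ => Finset.sum_nonneg fun _ _ => abs_nonneg _
  refine norm_le_of_mulVec_le _ h0 fun y => (pi_norm_le_iff_of_nonneg (by positivity)).mpr fun i => ?_
  rw [Matrix.mulVec, dotProduct]
  refine (norm_sum_le _ _).trans ?_
  calc _ ≤ ∑ j, |M i j| * ‖y‖ := Finset.sum_le_sum fun j _ => by
        rw [norm_mul]; exact mul_le_mul_of_nonneg_left (norm_le_pi_norm y j) (norm_nonneg _)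
    _ = (∑ j, |M i j|) * ‖y‖ := (Finset.sum_mul _ _ _).symm
    _ ≤ _ := mul_le_mul_of_nonneg_right (Finset.single_le_sum (f := fun i => ∑ j, |M i j|)
        (fun _ _ => Finset.sum_nonneg fun _ _ => abs_nonneg _) (Finset.mem_univ i)) (norm_nonneg _)

theorem sum_abs_le_card_mul_norm (M : Matrix κ κ ℝ) :
    ∑ i, ∑ j, |M i j| ≤ Fintype.card κ * (Fintype.card κ * ‖M‖) := by
  calc _ ≤ ∑ _i : κ, ∑ _j : κ, ‖M‖ :=
        Finset.sum_le_sum fun i _ => Finset.sum_le_sum fun j _ => norm_entry_le M i j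
    _ = _ := by simp

end Perturbation

/-! ### Integer approximations and their error -/

section Approximation

/-- The integers `zs`, divided by `2 ^ k`, approximate the real numbers `xs` up to `2 ^ (-k)`. -/
def IsApproximation (k : ℕ) (zs : List ℤ) (xs : List ℝ) : Prop :=
  List.Forall₂ (fun (z : ℤ) (x : ℝ) => |x - (z : ℝ) / 2 ^ k| ≤ 1 / 2 ^ k) zs xs

/-- An integer bounding, after division by `2 ^ k`, the norms of the matrices of an instance. -/
def magnitude (N k : ℕ) (zs : List ℤ) : ℕ := (N + 1) * (2 ^ k + (zs.map Int.natAbs).sum + 1)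

theorem natAbs_getD_le_sum (zs : List ℤ) (i : ℕ) :
    (zs.getD i 0).natAbs ≤ (zs.map Int.natAbs).sum := by
  induction zs generalizing i with
  | nil => simp
  | cons z zs ih =>
    cases i with
    | zero => simp
    | succ i =>
      have := ih i
      simp only [List.getD_cons_succ, List.map_cons, List.sum_cons]
      omega

variable {k : ℕ} {zs : List ℤ} {xs : List ℝ}

theorem IsApproximation.getD (h : IsApproximation k zs xs) (i : ℕ) :
    |xs.getD i 0 - (zs.getD i 0 : ℝ) / 2 ^ k| ≤ 1 / 2 ^ k := by
  unfold IsApproximation at h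
  induction h generalizing i with
  | nil => simp
  | cons h1 _ ih =>
    cases i with
    | zero => simpa using h1
    | succ i => simpa using ih i

theorem IsApproximation.sum_natAbs_le (h : IsApproximation k zs xs) :
    ((zs.map Int.natAbs).sum : ℝ) ≤ 2 ^ k * ((xs.map fun x => |x|).sum + xs.length) := by
  unfold IsApproximation at h
  induction h with
  | nil => simp
  | @cons z x zs xs h1 _ ih =>
    have hk : (1 : ℝ) ≤ 2 ^ k := one_le_pow₀ one_le_two
    have hk0 : (0 : ℝ) < 2 ^ k := by positivity
    have h2 : |(z : ℝ)| ≤ 2 ^ k * |x| + 1 := by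
      have h3 : |(z : ℝ) / 2 ^ k| ≤ |x| + 1 / 2 ^ k := by
        have := abs_sub_abs_le_abs_sub ((z : ℝ) / 2 ^ k) x
        rw [abs_sub_comm] at this
        linarith
      rw [abs_div, abs_of_pos hk0, div_le_iff₀ hk0] at h3
      calc |(z : ℝ)| ≤ _ := h3
        _ = _ := by field_simp
    simp only [List.map_cons, List.sum_cons, List.length_cons]
    push_cast
    rw [Nat.cast_natAbs, Int.cast_abs]
    push_cast at ih
    nlinarith

theorem abs_plantEntry_sub_le (h : IsApproximation k zs xs) (n m d i j : ℕ) :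
    |plantEntry n m d 1 (fun i => xs.getD i 0) i j -
      (plantEntry n m d (2 ^ k) (fun i => zs.getD i 0) i j : ℤ) / 2 ^ k| ≤ 1 / 2 ^ k := by
  unfold plantEntry
  split_ifs
  all_goals first | exact h.getD _ | simp

theorem abs_controlEntry_sub_le (h : IsApproximation k zs xs) (n m d a i j : ℕ) :
    |controlEntry n m d a 1 (fun i => xs.getD i 0) i j -
      (controlEntry n m d a (2 ^ k) (fun i => zs.getD i 0) i j : ℤ) / 2 ^ k| ≤ 1 / 2 ^ k := by
  unfold controlEntry
  split_ifs
  all_goals first | exact h.getD _ | simp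

theorem natAbs_plantEntry_le (n m d i j : ℕ) :
    (plantEntry n m d (2 ^ k) (fun i => zs.getD i 0) i j).natAbs ≤
      2 ^ k + (zs.map Int.natAbs).sum := by
  unfold plantEntry
  split_ifs
  all_goals first
    | exact (natAbs_getD_le_sum zs _).trans (Nat.le_add_left _ _)
    | simp [Int.natAbs_pow]

theorem natAbs_controlEntry_le (n m d a i j : ℕ) :
    (controlEntry n m d a (2 ^ k) (fun i => zs.getD i 0) i j).natAbs ≤
      2 ^ k + (zs.map Int.natAbs).sum := by
  unfold controlEntry
  split_ifs
  all_goals first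
    | exact (natAbs_getD_le_sum zs _).trans (Nat.le_add_left _ _)
    | simp [Int.natAbs_pow]

/-- An integer matrix at scale `2 ^ k`, as a real matrix. -/
noncomputable def scaled {N : ℕ} (k : ℕ) (Z : Matrix (Fin N) (Fin N) ℤ) :
    Matrix (Fin N) (Fin N) ℝ := ((2 : ℝ) ^ k)⁻¹ • (Int.castRingHom ℝ).mapMatrix Z

theorem scaled_mul {N : ℕ} (k l : ℕ) (Z W : Matrix (Fin N) (Fin N) ℤ) :
    scaled k Z * scaled l W = scaled (k + l) (Z * W) := by
  rw [scaled, scaled, scaled, map_mul, smul_mul_smul_comm, pow_add, mul_inv]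

theorem scaled_list_prod {N : ℕ} {α : Type*} (k : ℕ) (Z : α → Matrix (Fin N) (Fin N) ℤ)
    (w : List α) : (w.map fun a => scaled k (Z a)).prod = scaled (k * w.length) (w.map Z).prod := by
  induction w with
  | nil => simp [scaled]
  | cons a w ih =>
    rw [List.map_cons, List.prod_cons, ih, scaled_mul, List.map_cons, List.prod_cons,
      List.length_cons, Nat.mul_succ, add_comm]

theorem scaled_apply {N : ℕ} (k : ℕ) (Z : Matrix (Fin N) (Fin N) ℤ) (i j : Fin N) :
    scaled k Z i j = (Z i j : ℝ) / 2 ^ k := by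
  simp [scaled, div_eq_inv_mul]

theorem norm_scaled_sub_le {N : ℕ} {X : Matrix (Fin N) (Fin N) ℝ} {Z : Matrix (Fin N) (Fin N) ℤ}
    (h : ∀ i j, |X i j - (Z i j : ℝ) / 2 ^ k| ≤ 1 / 2 ^ k) : ‖X - scaled k Z‖ ≤ N / 2 ^ k := by
  have := norm_le_card_mul (X - scaled k Z) (c := 1 / 2 ^ k) (by positivity) fun i j => by
    rw [Matrix.sub_apply, scaled_apply]; exact h i j
  rwa [Fintype.card_fin, mul_one_div] at this

theorem norm_scaled_le {N : ℕ} {Z : Matrix (Fin N) (Fin N) ℤ}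
    (h : ∀ i j, (Z i j).natAbs ≤ 2 ^ k + (zs.map Int.natAbs).sum) :
    ‖scaled k Z‖ ≤ (N * (2 ^ k + (zs.map Int.natAbs).sum : ℕ) : ℝ) / 2 ^ k := by
  have := norm_le_card_mul (scaled k Z) (c := (2 ^ k + (zs.map Int.natAbs).sum : ℕ) / 2 ^ k)
    (by positivity) fun i j => by
      rw [scaled_apply, norm_div, Real.norm_eq_abs, ← Int.cast_abs, ← Nat.cast_natAbs, norm_pow,
        Real.norm_two]
      gcongr
      exact h i j
  rwa [Fintype.card_fin, ← mul_div_assoc] at this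

theorem norm_scaled_le_magnitude {N : ℕ} {Z : Matrix (Fin N) (Fin N) ℤ}
    (h : ∀ i j, (Z i j).natAbs ≤ 2 ^ k + (zs.map Int.natAbs).sum) :
    ‖scaled k Z‖ ≤ (magnitude N k zs : ℝ) / 2 ^ k := by
  refine (norm_scaled_le h).trans ?_
  gcongr
  rw [magnitude, ← Nat.cast_mul, Nat.cast_le]
  exact Nat.mul_le_mul (Nat.le_succ _) (Nat.le_succ _)

/-- The summands `1` in `magnitude` pay for the approximation error `N / 2 ^ k`, so one integer
bounds both the exact and the approximate matrix. -/
theorem norm_le_magnitude {N : ℕ} {X : Matrix (Fin N) (Fin N) ℝ} {Z : Matrix (Fin N) (Fin N) ℤ}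
    (h1 : ∀ i j, |X i j - (Z i j : ℝ) / 2 ^ k| ≤ 1 / 2 ^ k)
    (h : ∀ i j, (Z i j).natAbs ≤ 2 ^ k + (zs.map Int.natAbs).sum) :
    ‖X‖ ≤ (magnitude N k zs : ℝ) / 2 ^ k := by
  have h2 : ‖X‖ ≤ ‖X - scaled k Z‖ + ‖scaled k Z‖ := by
    simpa using norm_add_le (X - scaled k Z) (scaled k Z)
  refine (h2.trans (add_le_add (norm_scaled_sub_le h1) (norm_scaled_le h))).trans ?_
  rw [← add_div]
  gcongr
  rw [magnitude, ← Nat.cast_mul, ← Nat.cast_add, Nat.cast_le]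
  generalize 2 ^ k + (zs.map Int.natAbs).sum = T
  linarith [show (N + 1) * (T + 1) = N + N * T + (T + 1) by ring]

theorem one_le_magnitude_div (N k : ℕ) (zs : List ℤ) : 1 ≤ (magnitude N k zs : ℝ) / 2 ^ k := by
  have h : 2 ^ k ≤ magnitude N k zs := by
    rw [magnitude, add_assoc]
    exact (Nat.le_add_right _ _).trans (Nat.le_mul_of_pos_left _ N.succ_pos)
  rw [one_le_div (by positivity)]
  exact_mod_cast h

/-- An integer bounding, after division by `2 ^ (k * (2 * L + 2))`, the error of the products of
length `L`. -/
def errorBound (N k : ℕ) (zs : List ℤ) (L : ℕ) : ℕ := 2 * L * N * magnitude N k zs ^ (2 * L + 1)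

/-- The error of the approximate products of length `L`. -/
noncomputable def productError (N k : ℕ) (zs : List ℤ) (L : ℕ) : ℝ :=
  (errorBound N k zs L : ℝ) / 2 ^ (k * (2 * L + 2))

theorem productError_nonneg (N k : ℕ) (zs : List ℤ) (L : ℕ) : 0 ≤ productError N k zs L := by
  unfold productError; positivity

theorem productError_eq (N k : ℕ) (zs : List ℤ) (L : ℕ) : productError N k zs L =
    L * (2 * (N / 2 ^ k) * (magnitude N k zs / 2 ^ k)) *
      ((magnitude N k zs / 2 ^ k : ℝ) ^ 2) ^ L := by
  have h1 : (2 : ℝ) ^ (k * (2 * L + 2)) = 2 ^ k * 2 ^ k * (2 ^ k) ^ (2 * L) := by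
    rw [← pow_mul, ← pow_add, ← pow_add]; congr 1; ring
  have h2 : ((magnitude N k zs / 2 ^ k : ℝ) ^ 2) ^ L =
      (magnitude N k zs : ℝ) ^ (2 * L) / (2 ^ k) ^ (2 * L) := by rw [← pow_mul, div_pow]
  rw [productError, errorBound, h1, h2]
  push_cast
  have hx : (2 : ℝ) ^ k ≠ 0 := by positivity
  generalize (2 : ℝ) ^ k = x at hx
  field_simp
  ring

theorem IsApproximation.magnitude_div_le (h : IsApproximation k zs xs) (N : ℕ) :
    (magnitude N k zs : ℝ) / 2 ^ k ≤ (N + 1) * ((xs.map fun x => |x|).sum + xs.length + 2) := by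
  have hk : (1 : ℝ) ≤ 2 ^ k := one_le_pow₀ one_le_two
  rw [div_le_iff₀ (by positivity), magnitude]
  push_cast
  have := h.sum_natAbs_le
  push_cast at this
  rw [mul_assoc]
  gcongr
  linarith

/-- For fixed `L` the scaled magnitudes stay bounded independently of `k`, so the error decays like
`2 ^ (-k)`. -/
theorem tendsto_productError {φ : ℕ → List ℤ} (h : IsName φ xs) (N L : ℕ) :
    Filter.Tendsto (fun k => productError N k (φ k) L) Filter.atTop (nhds 0) := by
  set b : ℝ := (N + 1) * ((xs.map fun x => |x|).sum + xs.length + 2) with hb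
  have hb' : ∀ k, (magnitude N k (φ k) : ℝ) / 2 ^ k ≤ b := fun k =>
    IsApproximation.magnitude_div_le (h k) N
  have hb0 : 0 ≤ b := (by positivity : (0 : ℝ) ≤ (magnitude N 0 (φ 0) : ℝ) / 2 ^ 0).trans (hb' 0)
  have hlim : Filter.Tendsto (fun k : ℕ => (L * (2 * N * b) * (b ^ 2) ^ L) * (1 / 2 : ℝ) ^ k)
      Filter.atTop (nhds 0) := by
    have := (tendsto_pow_atTop_nhds_zero_of_lt_one (r := (1 / 2 : ℝ)) (by norm_num)
      (by norm_num)).const_mul (L * (2 * N * b) * (b ^ 2) ^ L)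
    rwa [mul_zero] at this
  refine squeeze_zero (fun k => productError_nonneg _ _ _ _) (fun k => ?_) hlim
  rw [productError_eq]
  calc _ ≤ L * (2 * (N / 2 ^ k) * b) * (b ^ 2) ^ L := by
        gcongr <;> exact hb' k
    _ = _ := by rw [one_div, inv_pow]; ring

end Approximation

namespace SwitchedDelay

variable {n m : ℕ} {S : SwitchedDelay n m} {K : S.Controller} {k : ℕ} {zs : List ℤ}

/-- The integer version of `liftMatrix`, at scale `2 ^ (2 * k)`. -/
def liftMatrixInt (n m d k : ℕ) (zs : List ℤ) (a : ℕ) :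
    Matrix (Fin (liftDim n m d)) (Fin (liftDim n m d)) ℤ :=
  plantMatrix n m d (2 ^ k) (fun i => zs.getD i 0) *
    controlMatrix n m d a (2 ^ k) (fun i => zs.getD i 0)

theorem norm_liftMatrix_prod_sub_le (h : IsApproximation k zs (S.realData K)) (w : List ℕ) :
    ‖(w.map (S.liftMatrix K)).prod -
      scaled (k * (2 * w.length)) (w.map (liftMatrixInt n m S.dmax k zs)).prod‖ ≤
      productError (liftDim n m S.dmax) k zs w.length := by
  set N := liftDim n m S.dmax
  set z := fun i => zs.getD i 0 with hz
  set b : ℝ := (magnitude N k zs : ℝ) / 2 ^ k with hb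
  have hb1 : 1 ≤ b := one_le_magnitude_div _ _ _
  have hP1 := abs_plantEntry_sub_le h n m S.dmax
  have hQ1 := abs_controlEntry_sub_le h n m S.dmax
  have hP2 := natAbs_plantEntry_le (k := k) (zs := zs) n m S.dmax
  have hQ2 := natAbs_controlEntry_le (k := k) (zs := zs) n m S.dmax
  set Pr := plantMatrix n m S.dmax 1 (S.dataAt K) with hPr
  set Pz := plantMatrix n m S.dmax (2 ^ k) z with hPz
  set Qr := fun a => controlMatrix n m S.dmax a 1 (S.dataAt K) with hQr
  set Qz := fun a => controlMatrix n m S.dmax a (2 ^ k) z with hQz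
  have nPr : ‖Pr‖ ≤ b := norm_le_magnitude (Z := Pz) (fun i j => hP1 i j) fun i j => hP2 i j
  have nPz : ‖scaled k Pz‖ ≤ b := norm_scaled_le_magnitude fun i j => hP2 i j
  have nQr : ∀ a, ‖Qr a‖ ≤ b := fun a =>
    norm_le_magnitude (Z := Qz a) (fun i j => hQ1 a i j) fun i j => hQ2 a i j
  have nQz : ∀ a, ‖scaled k (Qz a)‖ ≤ b := fun a => norm_scaled_le_magnitude fun i j => hQ2 a i j
  have dP : ‖Pr - scaled k Pz‖ ≤ N / 2 ^ k := norm_scaled_sub_le fun i j => hP1 i j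
  have dQ : ∀ a, ‖Qr a - scaled k (Qz a)‖ ≤ N / 2 ^ k := fun a =>
    norm_scaled_sub_le fun i j => hQ1 a i j
  have e : (w.map (liftMatrixInt n m S.dmax k zs)).prod =
      (w.map fun a => Pz * Qz a).prod := rfl
  have e' : scaled (k * (2 * w.length)) (w.map (liftMatrixInt n m S.dmax k zs)).prod =
      (w.map fun a => scaled k Pz * scaled k (Qz a)).prod := by
    rw [e]
    simp only [scaled_mul]
    rw [scaled_list_prod, ← mul_assoc, mul_two]
  rw [e', productError_eq]
  refine norm_prod_sub_prod_le (S.liftMatrix K) (fun a => scaled k Pz * scaled k (Qz a))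
    (b := b ^ 2) (one_le_pow₀ hb1) (by positivity) w (fun a _ => ?_) (fun a _ => ?_) fun a _ => ?_
  · rw [sq]
    exact (norm_mul_le _ _).trans (mul_le_mul nPr (nQr a) (norm_nonneg _) (by positivity))
  · rw [sq]
    exact (norm_mul_le _ _).trans (mul_le_mul nPz (nQz a) (norm_nonneg _) (by positivity))
  · have e2 : S.liftMatrix K a - scaled k Pz * scaled k (Qz a) =
        (Pr - scaled k Pz) * Qr a + scaled k Pz * (Qr a - scaled k (Qz a)) := by
      rw [liftMatrix]
      noncomm_ring
    rw [e2]
    calc _ ≤ ‖Pr - scaled k Pz‖ * ‖Qr a‖ + ‖scaled k Pz‖ * ‖Qr a - scaled k (Qz a)‖ :=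
          (norm_add_le _ _).trans (add_le_add (norm_mul_le _ _) (norm_mul_le _ _))
      _ ≤ N / 2 ^ k * b + b * (N / 2 ^ k) := by
          gcongr
          · exact nQr a
          · exact dQ a
      _ = _ := by ring

end SwitchedDelay

/-! ### Matrices as lists, for computability -/

/-- The list of rows of an `N × N` matrix. -/
def tableOf (N : ℕ) (f : ℕ → ℕ → ℤ) : List (List ℤ) :=
  (List.range N).map fun i => (List.range N).map fun j => f i j

/-- An entry of a matrix given by its list of rows. -/
def tableEntry (X : List (List ℤ)) (i j : ℕ) : ℤ := (X.getD i []).getD j 0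

/-- The product of two matrices given by their lists of rows. -/
def tableMul (N : ℕ) (X Y : List (List ℤ)) : List (List ℤ) :=
  tableOf N fun i j => ((List.range N).map fun l => tableEntry X i l * tableEntry Y l j).sum

/-- All products of `L` of the given matrices. -/
def tableProducts (N : ℕ) (Ts : List (List (List ℤ))) (L : ℕ) : List (List (List ℤ)) :=
  Nat.rec [tableOf N fun i j => if i = j then 1 else 0]
    (fun _ Xs => Xs.flatMap fun X => Ts.map fun T => tableMul N T X) L

/-- The sum of the absolute values of the entries. -/
def tableNorm (N : ℕ) (X : List (List ℤ)) : ℕ :=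
  ((List.range N).map fun i => ((List.range N).map fun j => (tableEntry X i j).natAbs).sum).sum

/-- The trace. -/
def tableTrace (N : ℕ) (X : List (List ℤ)) : ℤ :=
  ((List.range N).map fun i => tableEntry X i i).sum

/-- The matrix given by a list of rows. -/
def tableMatrix (N : ℕ) (X : List (List ℤ)) : Matrix (Fin N) (Fin N) ℤ :=
  Matrix.of fun i j => tableEntry X i j

theorem tableEntry_tableOf {N : ℕ} (f : ℕ → ℕ → ℤ) (i j : Fin N) :
    tableEntry (tableOf N f) i j = f i j := by
  simp [tableEntry, tableOf, List.getD_eq_getElem?_getD]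

theorem sum_map_range {M : Type*} [AddCommMonoid M] (N : ℕ) (f : ℕ → M) :
    ((List.range N).map f).sum = ∑ i : Fin N, f i := by
  rw [Fin.sum_univ_eq_sum_range, Finset.sum_range]
  rw [← Fin.sum_ofFn, List.ofFn_eq_map]
  congr 1
  rw [← List.map_coe_finRange_eq_range, List.map_map]
  rfl

theorem tableMatrix_tableMul (N : ℕ) (X Y : List (List ℤ)) :
    tableMatrix N (tableMul N X Y) = tableMatrix N X * tableMatrix N Y := by
  ext i j
  simp only [tableMatrix, Matrix.of_apply, tableMul, tableEntry_tableOf, Matrix.mul_apply]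
  exact sum_map_range N fun l => tableEntry X i l * tableEntry Y l j

theorem tableMatrix_one (N : ℕ) :
    tableMatrix N (tableOf N fun i j => if i = j then 1 else 0) = 1 := by
  ext i j
  simp only [tableMatrix, Matrix.of_apply, tableEntry_tableOf, Matrix.one_apply, Fin.ext_iff]

theorem tableNorm_eq (N : ℕ) (X : List (List ℤ)) :
    tableNorm N X = ∑ i, ∑ j, (tableMatrix N X i j).natAbs := by
  simp only [tableNorm, sum_map_range]
  rfl

theorem tableTrace_eq (N : ℕ) (X : List (List ℤ)) : tableTrace N X = (tableMatrix N X).trace := by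
  simp only [tableTrace, sum_map_range]
  rfl

theorem exists_word_of_mem_tableProducts {N : ℕ} (T : ℕ → List (List ℤ)) (l : List ℕ) {L : ℕ}
    {X : List (List ℤ)} (hX : X ∈ tableProducts N (l.map T) L) :
    ∃ w : List ℕ, w.length = L ∧ (∀ a ∈ w, a ∈ l) ∧
      tableMatrix N X = (w.map fun a => tableMatrix N (T a)).prod := by
  induction L generalizing X with
  | zero =>
    obtain rfl : X = _ := List.mem_singleton.mp hX
    exact ⟨[], rfl, by simp, by simpa using tableMatrix_one N⟩
  | succ L ih =>
    obtain ⟨Y, hY, hX⟩ := List.mem_flatMap.mp hX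
    simp only [List.map_map, List.mem_map, Function.comp] at hX
    obtain ⟨a, ha, rfl⟩ := hX
    obtain ⟨w, hw, hwl, hwY⟩ := ih hY
    refine ⟨a :: w, by simp [hw], by simpa [ha] using hwl, ?_⟩
    rw [tableMatrix_tableMul, hwY, List.map_cons, List.prod_cons]

theorem exists_mem_tableProducts {N : ℕ} (T : ℕ → List (List ℤ)) (l : List ℕ) (w : List ℕ)
    (hw : ∀ a ∈ w, a ∈ l) : ∃ X ∈ tableProducts N (l.map T) w.length,
      tableMatrix N X = (w.map fun a => tableMatrix N (T a)).prod := by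
  induction w with
  | nil => exact ⟨_, List.mem_singleton.mpr rfl, by simpa using tableMatrix_one N⟩
  | cons a w ih =>
    obtain ⟨Y, hY, hwY⟩ := ih fun b hb => hw b (by simp [hb])
    refine ⟨tableMul N (T a) Y, List.mem_flatMap.mpr ⟨Y, hY, ?_⟩, ?_⟩
    · exact List.mem_map.mpr ⟨T a, List.mem_map_of_mem (hw a (by simp)), rfl⟩
    · rw [tableMatrix_tableMul, hwY, List.map_cons, List.prod_cons]

/-! ### The finite tests: soundness and eventual success -/

/-- The largest element of a list of delays. -/
def delayMax (l : List ℕ) : ℕ := l.foldl max 0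

/-- The integer matrix of one step of the lifted closed loop, as a list of rows. -/
def stepTable (n m d k : ℕ) (zs : List ℤ) (a : ℕ) : List (List ℤ) :=
  tableMul (liftDim n m d)
    (tableOf (liftDim n m d) fun i j => plantEntry n m d (2 ^ k) (fun i => zs.getD i 0) i j)
    (tableOf (liftDim n m d) fun i j => controlEntry n m d a (2 ^ k) (fun i => zs.getD i 0) i j)

/-- The products of length `L` of the integer matrices of an instance. -/
def systemProducts (c : ℕ × ℕ × List ℕ) (k : ℕ) (zs : List ℤ) (L : ℕ) : List (List (List ℤ)) :=
  tableProducts (liftDim c.1 c.2.1 (delayMax c.2.2))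
    (c.2.2.map (stepTable c.1 c.2.1 (delayMax c.2.2) k zs)) L

/-- Certifies that the products grow at most at the rate `u / 2 ^ e`. -/
def UpperTest (c : ℕ × ℕ × List ℕ) (k : ℕ) (zs : List ℤ) (L u e : ℕ) : Prop :=
  ∀ X ∈ systemProducts c k zs L,
    (tableNorm (liftDim c.1 c.2.1 (delayMax c.2.2)) X * 2 ^ (k * 2) +
      errorBound (liftDim c.1 c.2.1 (delayMax c.2.2)) k zs L) * 2 ^ (e * L) <
        u ^ L * 2 ^ (k * (2 * L + 2))

/-- Certifies that the products do not grow at most at the rate `u / 2 ^ e`. -/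
def LowerTest (c : ℕ × ℕ × List ℕ) (k : ℕ) (zs : List ℤ) (L u e : ℕ) : Prop :=
  ∃ X ∈ systemProducts c k zs L,
    liftDim c.1 c.2.1 (delayMax c.2.2) * (u ^ L * 2 ^ (k * (2 * L + 2)) +
      errorBound (liftDim c.1 c.2.1 (delayMax c.2.2)) k zs L * 2 ^ (e * L)) <
        (tableTrace (liftDim c.1 c.2.1 (delayMax c.2.2)) X).natAbs * 2 ^ (k * 2) * 2 ^ (e * L)

theorem delayMax_le_iff (l : List ℕ) (b : ℕ) : delayMax l ≤ b ↔ ∀ a ∈ l, a ≤ b := by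
  have : ∀ (l : List ℕ) (c : ℕ), l.foldl max c ≤ b ↔ c ≤ b ∧ ∀ a ∈ l, a ≤ b := by
    intro l
    induction l with
    | nil => simp
    | cons a l ih => intro c; simp [ih, and_assoc]
  rw [delayMax, this]
  simp

theorem tableMatrix_tableOf (N : ℕ) (f : ℕ → ℕ → ℤ) :
    tableMatrix N (tableOf N f) = Matrix.of fun i j : Fin N => f i j := by
  ext i j
  exact tableEntry_tableOf f i j

theorem ProductsBounded.mono {ι κ : Type*} [Fintype κ] [DecidableEq κ] {F : ι → Matrix κ κ ℝ}
    {s s' : ℝ} (hs : 0 ≤ s) (hss' : s ≤ s') (h : ProductsBounded F s) : ProductsBounded F s' := by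
  obtain ⟨C, hC⟩ := h
  refine ⟨|C|, fun w => (hC w).trans ?_⟩
  have := le_abs_self C
  gcongr

namespace SwitchedDelay

variable {n m : ℕ} {S : SwitchedDelay n m} {K : S.Controller} {k : ℕ} {zs : List ℤ}

theorem delayMax_discreteData : delayMax S.discreteData.2.2 = S.dmax := by
  refine le_antisymm ((delayMax_le_iff _ _).mpr fun a ha => le_dmax ?_) ?_
  · simpa [discreteData] using ha
  · refine (delayMax_le_iff S.discreteData.2.2 _).mp le_rfl _ ?_
    simpa [discreteData, dmax] using S.D.max'_mem S.D_nonempty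

theorem tableMatrix_stepTable (n m d k : ℕ) (zs : List ℤ) (a : ℕ) :
    tableMatrix (liftDim n m d) (stepTable n m d k zs a) = liftMatrixInt n m d k zs a := by
  rw [stepTable, tableMatrix_tableMul, tableMatrix_tableOf, tableMatrix_tableOf]
  rfl

theorem exists_word_of_mem_systemProducts {L : ℕ} {X : List (List ℤ)}
    (hX : X ∈ systemProducts S.discreteData k zs L) : ∃ w : List S.D, w.length = L ∧
      tableMatrix (liftDim n m S.dmax) X =
        ((w.map Subtype.val).map (liftMatrixInt n m S.dmax k zs)).prod := by
  rw [systemProducts, delayMax_discreteData] at hX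
  obtain ⟨w, hw, hwl, hX⟩ := exists_word_of_mem_tableProducts _ _ hX
  simp only [discreteData, Finset.mem_sort] at hwl
  refine ⟨w.pmap Subtype.mk hwl, by simpa using hw, ?_⟩
  rw [List.map_pmap, List.pmap_eq_map, List.map_id']
  rw [← funext (tableMatrix_stepTable n m S.dmax k zs)]
  exact hX

theorem exists_mem_systemProducts (w : List S.D) :
    ∃ X ∈ systemProducts S.discreteData k zs w.length, tableMatrix (liftDim n m S.dmax) X =
        ((w.map Subtype.val).map (liftMatrixInt n m S.dmax k zs)).prod := by
  rw [systemProducts, delayMax_discreteData]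
  obtain ⟨X, hX, hXw⟩ := exists_mem_tableProducts (N := liftDim n m S.dmax)
    (stepTable n m S.dmax k zs) S.discreteData.2.2 (w.map Subtype.val)
    fun a ha => by
      obtain ⟨b, -, rfl⟩ := List.mem_map.mp ha
      simp [discreteData]
  rw [List.length_map] at hX
  refine ⟨X, hX, ?_⟩
  rw [← funext (tableMatrix_stepTable n m S.dmax k zs)]
  exact hXw

/-- Comparison of the norm and of the trace of a product with those of its approximation. -/
theorem word_estimates (h : IsApproximation k zs (S.realData K)) (w : List S.D)
    {X : List (List ℤ)} (hX : tableMatrix (liftDim n m S.dmax) X =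
      ((w.map Subtype.val).map (liftMatrixInt n m S.dmax k zs)).prod) :
    ‖(w.map (S.liftFamily K)).prod‖ ≤
        (tableNorm (liftDim n m S.dmax) X : ℝ) / 2 ^ (k * (2 * w.length)) +
          productError (liftDim n m S.dmax) k zs w.length ∧
      (tableNorm (liftDim n m S.dmax) X : ℝ) / 2 ^ (k * (2 * w.length)) ≤
        (liftDim n m S.dmax : ℝ) ^ 2 * (‖(w.map (S.liftFamily K)).prod‖ +
          productError (liftDim n m S.dmax) k zs w.length) ∧
      |(w.map (S.liftFamily K)).prod.trace -
        (tableTrace (liftDim n m S.dmax) X : ℝ) / 2 ^ (k * (2 * w.length))| ≤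
          liftDim n m S.dmax * productError (liftDim n m S.dmax) k zs w.length := by
  set N := liftDim n m S.dmax
  have h1 := norm_liftMatrix_prod_sub_le h (w.map Subtype.val)
  rw [List.length_map, List.map_map] at h1
  change ‖(w.map (S.liftFamily K)).prod - _‖ ≤ _ at h1
  rw [← hX] at h1
  set M := (w.map (S.liftFamily K)).prod
  set Y := scaled (k * (2 * w.length)) (tableMatrix N X) with hY
  set E := productError N k zs w.length
  have hnorm : (tableNorm N X : ℝ) / 2 ^ (k * (2 * w.length)) = ∑ i, ∑ j, |Y i j| := by
    rw [tableNorm_eq]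
    push_cast
    simp only [Finset.sum_div, hY, scaled_apply, abs_div, Nat.cast_natAbs, Int.cast_abs, abs_pow,
      Nat.abs_ofNat]
  have htr : (tableTrace N X : ℝ) / 2 ^ (k * (2 * w.length)) = Y.trace := by
    rw [tableTrace_eq, Matrix.trace, Matrix.trace]
    push_cast
    simp only [Finset.sum_div, Matrix.diag, hY, scaled_apply]
  rw [hnorm, htr]
  refine ⟨?_, ?_, ?_⟩
  · have h2 : ‖M‖ ≤ ‖M - Y‖ + ‖Y‖ := by simpa using norm_add_le (M - Y) Y
    linarith [norm_le_sum_abs Y]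
  · have h2 : ‖Y‖ ≤ ‖M‖ + E := by
      have := norm_sub_le M (M - Y)
      rw [sub_sub_cancel] at this
      linarith
    have h3 := sum_abs_le_card_mul_norm Y
    rw [Fintype.card_fin] at h3
    calc _ ≤ _ := h3
      _ = (N : ℝ) ^ 2 * ‖Y‖ := by ring
      _ ≤ _ := by gcongr
  · rw [← Matrix.trace_sub]
    refine (abs_trace_le_card_mul_norm _).trans ?_
    rw [Fintype.card_fin]
    gcongr

/-- The integer inequality results from multiplication by the common denominator `2 ^ (k * (2 * L +
2)) * 2 ^ (e * L)`. The same holds for `lower_inequality_iff`. -/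
theorem upper_inequality_iff (T N k : ℕ) (zs : List ℤ) (L u e : ℕ) :
    (T * 2 ^ (k * 2) + errorBound N k zs L) * 2 ^ (e * L) < u ^ L * 2 ^ (k * (2 * L + 2)) ↔
      (T : ℝ) / 2 ^ (k * (2 * L)) + productError N k zs L < ((u : ℝ) / 2 ^ e) ^ L := by
  have h1 : (2 : ℝ) ^ (k * (2 * L + 2)) = 2 ^ (k * (2 * L)) * 2 ^ (k * 2) := by
    rw [← pow_add]; congr 1; ring
  have h2 : (T : ℝ) / 2 ^ (k * (2 * L)) + productError N k zs L =
      (T * 2 ^ (k * 2) + errorBound N k zs L) / 2 ^ (k * (2 * L + 2)) := by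
    rw [productError, add_div, h1]
    congr 1
    field_simp
  rw [h2, div_pow, ← pow_mul, div_lt_div_iff₀ (by positivity) (by positivity)]
  norm_cast

theorem lower_inequality_iff (T N k : ℕ) (zs : List ℤ) (L u e : ℕ) :
    N * (u ^ L * 2 ^ (k * (2 * L + 2)) + errorBound N k zs L * 2 ^ (e * L)) <
        T * 2 ^ (k * 2) * 2 ^ (e * L) ↔
      N * ((u : ℝ) / 2 ^ e) ^ L + N * productError N k zs L < (T : ℝ) / 2 ^ (k * (2 * L)) := by
  have h1 : (2 : ℝ) ^ (k * (2 * L + 2)) = 2 ^ (k * (2 * L)) * 2 ^ (k * 2) := by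
    rw [← pow_add]; congr 1; ring
  have h2 : N * ((u : ℝ) / 2 ^ e) ^ L + N * productError N k zs L =
      N * (u ^ L * 2 ^ (k * (2 * L + 2)) + errorBound N k zs L * 2 ^ (e * L)) /
        (2 ^ (k * (2 * L + 2)) * 2 ^ (e * L)) := by
    rw [productError, div_pow, ← pow_mul]
    field_simp
  have h3 : (T : ℝ) / 2 ^ (k * (2 * L)) =
      T * 2 ^ (k * 2) * 2 ^ (e * L) / (2 ^ (k * (2 * L + 2)) * 2 ^ (e * L)) := by
    rw [h1]
    field_simp
  rw [h2, h3, div_lt_div_iff_of_pos_right (by positivity)]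
  norm_cast

theorem productsBounded_of_upperTest (h : IsApproximation k zs (S.realData K)) {L u e : ℕ}
    (hL : 1 ≤ L) (ht : UpperTest S.discreteData k zs L u e) :
    ProductsBounded (S.liftFamily K) ((u : ℝ) / 2 ^ e) := by
  rw [UpperTest, delayMax_discreteData] at ht
  have hle : ∀ w : List S.D, w.length = L →
      ‖(w.map (S.liftFamily K)).prod‖ < ((u : ℝ) / 2 ^ e) ^ L := by
    rintro w rfl
    obtain ⟨X, hX, hXw⟩ := exists_mem_systemProducts (k := k) (zs := zs) w
    exact (word_estimates h w hXw).1.trans_lt ((upper_inequality_iff _ _ _ _ _ _ _).mp (ht X hX))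
  have hu : 0 < (u : ℝ) / 2 ^ e := by
    obtain ⟨a, ha⟩ := S.D_nonempty
    have h1 := (norm_nonneg _).trans_lt (hle (List.replicate L ⟨a, ha⟩) (by simp))
    refine lt_of_le_of_ne (by positivity) fun h0 => ?_
    rw [← h0, zero_pow (by omega)] at h1
    exact lt_irrefl _ h1
  exact productsBounded_of_norm_le_pow _ hu hL fun w hw => (hle w hw).le

/-- This ensures that the natural subtraction in the rate tested by `decisionTest` was not
truncated. -/
theorem pos_of_upperTest {L u e : ℕ} (hL : 1 ≤ L) (ht : UpperTest S.discreteData k zs L u e) :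
    0 < u := by
  obtain ⟨a, ha⟩ := S.D_nonempty
  obtain ⟨X, hX, -⟩ := exists_mem_systemProducts (k := k) (zs := zs) (List.replicate L (⟨a, ha⟩ : S.D))
  rw [List.length_replicate] at hX
  have h1 := ht X hX
  rcases Nat.eq_zero_or_pos u with rfl | hu
  · rw [zero_pow (by omega), zero_mul] at h1
    omega
  · exact hu

theorem not_productsBounded_of_lowerTest (h : IsApproximation k zs (S.realData K)) {L u e : ℕ}
    (ht : LowerTest S.discreteData k zs L u e) :
    ¬ ProductsBounded (S.liftFamily K) ((u : ℝ) / 2 ^ e) := by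
  rw [LowerTest, delayMax_discreteData] at ht
  obtain ⟨X, hX, hlt⟩ := ht
  obtain ⟨w, rfl, hXw⟩ := exists_word_of_mem_systemProducts hX
  intro hb
  have h1 := (word_estimates h w hXw).2.2
  have h2 := hb.abs_trace_le (by positivity) w
  rw [Fintype.card_fin] at h2
  have h3 := (lower_inequality_iff _ _ _ _ _ _ _).mp hlt
  rw [Nat.cast_natAbs, Int.cast_abs] at h3
  rw [abs_sub_comm] at h1
  have h4 := (abs_sub_abs_le_abs_sub _ _).trans h1
  rw [abs_div, abs_of_pos (show (0 : ℝ) < 2 ^ (k * (2 * w.length)) by positivity)] at h4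
  change liftDim n m S.dmax * ((u : ℝ) / 2 ^ e) ^ w.length + liftDim n m S.dmax *
    productError (liftDim n m S.dmax) k zs w.length <
      |(tableTrace (liftDim n m S.dmax) X : ℝ)| / 2 ^ (k * (2 * w.length)) at h3
  linarith

/-- The length is fixed first, so that `s' ^ L` beats the constant and the factor `N ^ 2` lost
between the operator norm and the sum of the entries; then the precision makes the error negligible.
Uniformity in `u` and `e` is needed because `decisionTest` tests a rate that moves with the
precision. -/
theorem eventually_upperTest {φ : ℕ → List ℤ} (h : IsName φ (S.realData K)) {s s' : ℝ}
    (hs : 0 < s) (hss' : s < s') (hb : ProductsBounded (S.liftFamily K) s) :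
    ∃ L : ℕ, ∀ᶠ k in Filter.atTop, ∀ u e : ℕ, s' ≤ (u : ℝ) / 2 ^ e →
      UpperTest S.discreteData k (φ k) (L + 1) u e := by
  obtain ⟨C, hC⟩ := hb
  set N := liftDim n m S.dmax
  obtain ⟨L, hL⟩ := pow_unbounded_of_one_lt ((N : ℝ) ^ 2 * |C|) ((one_lt_div hs).mpr hss')
  have hL' : (N : ℝ) ^ 2 * (|C| * s ^ (L + 1)) < s' ^ (L + 1) := by
    have h1 := hL.trans_le (pow_le_pow_right₀ ((one_lt_div hs).mpr hss').le (Nat.le_succ L))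
    rwa [div_pow, lt_div_iff₀ (by positivity), Nat.succ_eq_add_one, mul_assoc] at h1
  refine ⟨L, ?_⟩
  have hlim : Filter.Tendsto (fun k => (N : ℝ) ^ 2 * (|C| * s ^ (L + 1) +
      productError N k (φ k) (L + 1)) + productError N k (φ k) (L + 1)) Filter.atTop
      (nhds ((N : ℝ) ^ 2 * (|C| * s ^ (L + 1) + 0) + 0)) :=
    ((tendsto_const_nhds.add (tendsto_productError h N (L + 1))).const_mul _).add
      (tendsto_productError h N (L + 1))
  rw [add_zero, add_zero] at hlim
  filter_upwards [hlim.eventually_lt_const hL'] with k hk u e hu X hX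
  rw [delayMax_discreteData]
  obtain ⟨w, hw, hXw⟩ := exists_word_of_mem_systemProducts hX
  have h2 := (word_estimates (h k) w hXw).2.1
  refine (upper_inequality_iff _ _ _ _ _ _ _).mpr ?_
  have h3 : ‖(w.map (S.liftFamily K)).prod‖ ≤ |C| * s ^ (L + 1) := by
    refine (hC w).trans ?_
    rw [hw]
    have := le_abs_self C
    gcongr
  rw [hw] at h2
  calc _ ≤ (N : ℝ) ^ 2 * (|C| * s ^ (L + 1) + productError N k (φ k) (L + 1)) +
        productError N k (φ k) (L + 1) := by
        refine add_le_add (h2.trans ?_) le_rfl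
        gcongr
    _ < s' ^ (L + 1) := hk
    _ ≤ _ := pow_le_pow_left₀ (hs.trans hss').le hu _

/-- The contrapositive of the trace criterion provides one word whose trace is strictly too large,
and a strict inequality survives small errors. -/
theorem eventually_lowerTest {φ : ℕ → List ℤ} (h : IsName φ (S.realData K)) {s s' : ℝ}
    (hs : 0 < s) (hss' : s < s') (hb : ¬ ProductsBounded (S.liftFamily K) s') :
    ∃ L : ℕ, ∀ᶠ k in Filter.atTop, ∀ u e : ℕ, (u : ℝ) / 2 ^ e ≤ s →
      LowerTest S.discreteData k (φ k) (L + 1) u e := by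
  set N := liftDim n m S.dmax
  have hw : ∃ w : List S.D, N * s ^ w.length < |(w.map (S.liftFamily K)).prod.trace| := by
    by_contra! hc
    exact hb (productsBounded_of_abs_trace_le _ hs hss' hc)
  obtain ⟨w, hw⟩ := hw
  -- The empty word is excluded because the identity has trace exactly `N`.
  obtain ⟨L, hL⟩ : ∃ L, w.length = L + 1 := by
    refine Nat.exists_eq_succ_of_ne_zero fun h0 => ?_
    rw [List.length_eq_zero_iff.mp h0] at hw
    simp [N] at hw
  refine ⟨L, ?_⟩
  have hlim : Filter.Tendsto (fun k => N * s ^ w.length + N * productError N k (φ k) w.length +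
      N * productError N k (φ k) w.length) Filter.atTop
      (nhds (N * s ^ w.length + N * 0 + N * 0)) :=
    (tendsto_const_nhds.add ((tendsto_productError h N _).const_mul _)).add
      ((tendsto_productError h N _).const_mul _)
  rw [mul_zero, add_zero, add_zero] at hlim
  filter_upwards [hlim.eventually_lt_const hw] with k hk u e hu
  obtain ⟨X, hX, hXw⟩ := exists_mem_systemProducts (k := k) (zs := φ k) w
  have h1 := (word_estimates (h k) w hXw).2.2
  rw [LowerTest, delayMax_discreteData, ← hL]
  refine ⟨X, hX, (lower_inequality_iff _ _ _ _ _ _ _).mpr ?_⟩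
  have h4 := (abs_sub_abs_le_abs_sub _ _).trans h1
  rw [Nat.cast_natAbs, Int.cast_abs]
  rw [abs_div, abs_of_pos (show (0 : ℝ) < 2 ^ (k * (2 * w.length)) by positivity)] at h4
  have h5 : N * ((u : ℝ) / 2 ^ e) ^ w.length ≤ N * s ^ w.length := by gcongr
  change N * ((u : ℝ) / 2 ^ e) ^ w.length + N * productError N k (φ k) w.length <
    |(tableTrace N X : ℝ)| / 2 ^ (k * (2 * w.length))
  linarith

end SwitchedDelay

/-! ### Primitive recursiveness of the tests -/

section Computability

variable {α : Type*} [Primcodable α]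

theorem primrec_int_ofNat : Primrec (fun n : ℕ => (n : ℤ)) := by
  rw [← Primrec.encode_iff]
  exact (Primrec.nat_double).of_eq fun n => rfl

theorem primrec_int_negSucc : Primrec Int.negSucc := by
  rw [← Primrec.encode_iff]
  exact (Primrec.nat_double_succ).of_eq fun n => rfl

/-- The encoding sends `n` to `2 * n` and `-(n + 1)` to `2 * n + 1`, so parity is the sign. Integer
arithmetic is then done on positive and negative parts. -/
theorem primrec_int_toNat : Primrec Int.toNat := by
  have h : Primrec fun z : ℤ => if Encodable.encode z % 2 = 0 then Encodable.encode z / 2 else 0 :=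
    Primrec.ite (Primrec.eq.comp (Primrec.nat_mod.comp Primrec.encode (Primrec.const 2))
      (Primrec.const 0)) (Primrec.nat_div.comp Primrec.encode (Primrec.const 2)) (Primrec.const 0)
  refine h.of_eq fun z => ?_
  cases z with
  | ofNat n =>
    have : Encodable.encode (Int.ofNat n) = 2 * n := rfl
    rw [this, if_pos (by omega)]
    simp
  | negSucc n =>
    have : Encodable.encode (Int.negSucc n) = 2 * n + 1 := rfl
    rw [this, if_neg (by omega)]
    rfl

theorem primrec_int_toNat_neg : Primrec fun z : ℤ => (-z).toNat := by
  have h : Primrec fun z : ℤ =>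
      if Encodable.encode z % 2 = 0 then 0 else Encodable.encode z / 2 + 1 :=
    Primrec.ite (Primrec.eq.comp (Primrec.nat_mod.comp Primrec.encode (Primrec.const 2))
      (Primrec.const 0)) (Primrec.const 0)
      (Primrec.succ.comp (Primrec.nat_div.comp Primrec.encode (Primrec.const 2)))
  refine h.of_eq fun z => ?_
  cases z with
  | ofNat n =>
    have : Encodable.encode (Int.ofNat n) = 2 * n := rfl
    rw [this, if_pos (by omega)]
    simp
  | negSucc n =>
    have : Encodable.encode (Int.negSucc n) = 2 * n + 1 := rfl
    rw [this, if_neg (by omega), Int.neg_negSucc]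
    omega

theorem primrec_int_natAbs : Primrec Int.natAbs :=
  (Primrec.nat_add.comp primrec_int_toNat primrec_int_toNat_neg).of_eq fun z => by omega

theorem primrec_int_sub_nat : Primrec₂ fun a b : ℕ => (a : ℤ) - b := by
  have h : Primrec₂ fun a b : ℕ => if b ≤ a then ((a - b : ℕ) : ℤ) else Int.negSucc (b - a - 1) :=
    Primrec.ite (Primrec.nat_le.comp Primrec.snd Primrec.fst)
      (primrec_int_ofNat.comp (Primrec.nat_sub.comp Primrec.fst Primrec.snd))
      (primrec_int_negSucc.comp (Primrec.nat_sub.comp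
        (Primrec.nat_sub.comp Primrec.snd Primrec.fst) (Primrec.const 1)))
  refine h.of_eq fun a b => ?_
  split_ifs <;> omega

theorem primrec_int_add : Primrec₂ fun z w : ℤ => z + w := by
  have h : Primrec₂ fun z w : ℤ =>
      ((z.toNat + w.toNat : ℕ) : ℤ) - ((-z).toNat + (-w).toNat : ℕ) :=
    primrec_int_sub_nat.comp
      (Primrec.nat_add.comp (primrec_int_toNat.comp Primrec.fst) (primrec_int_toNat.comp Primrec.snd))
      (Primrec.nat_add.comp (primrec_int_toNat_neg.comp Primrec.fst)
        (primrec_int_toNat_neg.comp Primrec.snd))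
  exact h.of_eq fun z w => by omega

theorem primrec_int_mul : Primrec₂ fun z w : ℤ => z * w := by
  have hp : Primrec fun p : ℤ × ℤ => p.1.toNat := primrec_int_toNat.comp Primrec.fst
  have hq : Primrec fun p : ℤ × ℤ => p.2.toNat := primrec_int_toNat.comp Primrec.snd
  have hp' : Primrec fun p : ℤ × ℤ => (-p.1).toNat := primrec_int_toNat_neg.comp Primrec.fst
  have hq' : Primrec fun p : ℤ × ℤ => (-p.2).toNat := primrec_int_toNat_neg.comp Primrec.snd
  have h : Primrec₂ fun z w : ℤ => ((z.toNat * w.toNat + (-z).toNat * (-w).toNat : ℕ) : ℤ) -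
      (z.toNat * (-w).toNat + (-z).toNat * w.toNat : ℕ) :=
    primrec_int_sub_nat.comp
      (Primrec.nat_add.comp (Primrec.nat_mul.comp hp hq) (Primrec.nat_mul.comp hp' hq'))
      (Primrec.nat_add.comp (Primrec.nat_mul.comp hp hq') (Primrec.nat_mul.comp hp' hq))
  refine h.of_eq fun z w => ?_
  have hz : z = (z.toNat : ℤ) - (-z).toNat := by omega
  have hw : w = (w.toNat : ℤ) - (-w).toNat := by omega
  conv_rhs => rw [hz, hw]
  push_cast
  ring

theorem primrec_nat_pow : Primrec₂ fun a b : ℕ => a ^ b :=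
  Primrec₂.unpaired'.mp Nat.Primrec.pow

theorem primrec_nat_sum : Primrec (List.sum : List ℕ → ℕ) := by
  have h : Primrec₂ fun (_ : List ℕ) (p : ℕ × ℕ) => p.1 + p.2 :=
    Primrec.nat_add.comp (Primrec.fst.comp Primrec.snd) (Primrec.snd.comp Primrec.snd)
  exact (Primrec.list_foldr Primrec.id (Primrec.const 0) h).of_eq fun _ => List.sum_eq_foldr.symm

theorem primrec_int_sum : Primrec (List.sum : List ℤ → ℤ) := by
  have h : Primrec₂ fun (_ : List ℤ) (p : ℤ × ℤ) => p.1 + p.2 :=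
    primrec_int_add.comp (Primrec.fst.comp Primrec.snd) (Primrec.snd.comp Primrec.snd)
  exact (Primrec.list_foldr Primrec.id (Primrec.const 0) h).of_eq fun _ => List.sum_eq_foldr.symm

theorem primrec_tableOf {N : α → ℕ} {f : α → ℕ → ℕ → ℤ} (hN : Primrec N)
    (hf : Primrec fun p : (α × ℕ) × ℕ => f p.1.1 p.1.2 p.2) :
    Primrec fun a => tableOf (N a) (f a) :=
  Primrec.list_map (Primrec.list_range.comp hN)
    (Primrec₂.mk (Primrec.list_map (Primrec.list_range.comp (hN.comp Primrec.fst)) (Primrec₂.mk hf)))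

theorem primrec_tableEntry {X : α → List (List ℤ)} {i j : α → ℕ} (hX : Primrec X) (hi : Primrec i)
    (hj : Primrec j) : Primrec fun a => tableEntry (X a) (i a) (j a) :=
  (Primrec.list_getD 0).comp ((Primrec.list_getD []).comp hX hi) hj

theorem primrec_tableMul {N : α → ℕ} {X Y : α → List (List ℤ)} (hN : Primrec N) (hX : Primrec X)
    (hY : Primrec Y) : Primrec fun a => tableMul (N a) (X a) (Y a) := by
  refine primrec_tableOf hN (primrec_int_sum.comp (Primrec.list_map
    (Primrec.list_range.comp (hN.comp (Primrec.fst.comp Primrec.fst))) (Primrec₂.mk ?_)))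
  have h0 : Primrec fun p : ((α × ℕ) × ℕ) × ℕ => p.1.1.1 :=
    Primrec.fst.comp (Primrec.fst.comp Primrec.fst)
  exact primrec_int_mul.comp
    (primrec_tableEntry (hX.comp h0) (Primrec.snd.comp (Primrec.fst.comp Primrec.fst)) Primrec.snd)
    (primrec_tableEntry (hY.comp h0) Primrec.snd (Primrec.snd.comp Primrec.fst))

theorem primrec_tableProducts {N L : α → ℕ} {Ts : α → List (List (List ℤ))} (hN : Primrec N)
    (hT : Primrec Ts) (hL : Primrec L) : Primrec fun a => tableProducts (N a) (Ts a) (L a) := by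
  have h0 : Primrec fun a => [tableOf (N a) fun i j => if i = j then 1 else 0] :=
    Primrec.list_cons.comp (primrec_tableOf hN (Primrec.ite
      (Primrec.eq.comp (Primrec.snd.comp Primrec.fst) Primrec.snd) (Primrec.const 1)
      (Primrec.const 0))) (Primrec.const [])
  have hmul : Primrec₂ fun (q : (α × (ℕ × List (List (List ℤ)))) × List (List ℤ))
      (T : List (List ℤ)) => tableMul (N q.1.1) T q.2 :=
    primrec_tableMul (hN.comp (Primrec.fst.comp (Primrec.fst.comp Primrec.fst))) Primrec.snd
      (Primrec.snd.comp Primrec.fst)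
  have hmap : Primrec₂ fun (p : α × (ℕ × List (List (List ℤ)))) (X : List (List ℤ)) =>
      (Ts p.1).map fun T => tableMul (N p.1) T X :=
    Primrec.list_map (hT.comp (Primrec.fst.comp Primrec.fst)) hmul
  have hstep : Primrec₂ fun (a : α) (p : ℕ × List (List (List ℤ))) =>
      p.2.flatMap fun X => (Ts a).map fun T => tableMul (N a) T X :=
    Primrec.list_flatMap (Primrec.snd.comp Primrec.snd) hmap
  exact Primrec.nat_rec' hL h0 hstep

theorem primrec_tableNorm {N : α → ℕ} {X : α → List (List ℤ)} (hN : Primrec N) (hX : Primrec X) :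
    Primrec fun a => tableNorm (N a) (X a) :=
  primrec_nat_sum.comp (Primrec.list_map (Primrec.list_range.comp hN) (Primrec₂.mk
    (primrec_nat_sum.comp (Primrec.list_map (Primrec.list_range.comp (hN.comp Primrec.fst))
      (Primrec₂.mk (primrec_int_natAbs.comp (primrec_tableEntry
        (hX.comp (Primrec.fst.comp Primrec.fst)) (Primrec.snd.comp Primrec.fst) Primrec.snd)))))))

theorem primrec_tableTrace {N : α → ℕ} {X : α → List (List ℤ)} (hN : Primrec N) (hX : Primrec X) :
    Primrec fun a => tableTrace (N a) (X a) :=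
  primrec_int_sum.comp (Primrec.list_map (Primrec.list_range.comp hN) (Primrec₂.mk
    (primrec_tableEntry (hX.comp Primrec.fst) Primrec.snd Primrec.snd)))

section Entries

variable {n m d e i j : α → ℕ} {one : α → ℤ} {zs : α → List ℤ}

theorem primrec_liftDim (hn : Primrec n) (hm : Primrec m) (hd : Primrec d) :
    Primrec fun a => liftDim (n a) (m a) (d a) :=
  Primrec.nat_add.comp hn (Primrec.nat_mul.comp
    (Primrec.nat_mul.comp (Primrec.const 2) (Primrec.succ.comp hd)) hm)

theorem primrec_plantEntry (hn : Primrec n) (hm : Primrec m) (hd : Primrec d) (h1 : Primrec one)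
    (hz : Primrec zs) (hi : Primrec i) (hj : Primrec j) :
    Primrec fun a => plantEntry (n a) (m a) (d a) (one a) (fun l => (zs a).getD l 0) (i a) (j a) := by
  have hget : ∀ {l : α → ℕ}, Primrec l → Primrec fun a => (zs a).getD (l a) 0 := fun hl =>
    (Primrec.list_getD 0).comp hz hl
  have hin := Primrec.nat_div.comp (Primrec.nat_sub.comp hi hn) hm
  have hjn := Primrec.nat_sub.comp hj hn
  refine Primrec.ite (Primrec.nat_lt.comp hi hn)
    (Primrec.ite (Primrec.nat_lt.comp hj hn)
      (hget (Primrec.nat_add.comp (Primrec.nat_mul.comp hi hn) hj))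
      (Primrec.ite (Primrec.eq.comp (Primrec.nat_div.comp hjn hm) (Primrec.succ.comp hd))
        (hget (Primrec.nat_add.comp (Primrec.nat_mul.comp hn hn) (Primrec.nat_add.comp
          (Primrec.nat_mul.comp hi hm) (Primrec.nat_mod.comp hjn hm)))) (Primrec.const 0)))
    (Primrec.ite (PrimrecPred.and (PrimrecPred.not (Primrec.eq.comp hin hd))
      (Primrec.eq.comp hj (Primrec.nat_add.comp hi hm))) h1 (Primrec.const 0))

theorem primrec_controlEntry (hn : Primrec n) (hm : Primrec m) (hd : Primrec d) (he : Primrec e)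
    (h1 : Primrec one) (hz : Primrec zs) (hi : Primrec i) (hj : Primrec j) :
    Primrec fun a => controlEntry (n a) (m a) (d a) (e a) (one a) (fun l => (zs a).getD l 0)
      (i a) (j a) := by
  have hget : ∀ {l : α → ℕ}, Primrec l → Primrec fun a => (zs a).getD (l a) 0 := fun hl =>
    (Primrec.list_getD 0).comp hz hl
  have hin := Primrec.nat_sub.comp hi hn
  have hq := Primrec.nat_div.comp hin hm
  have hc := Primrec.nat_add.comp hn (Primrec.nat_mul.comp hd hm)
  refine Primrec.ite (PrimrecPred.and (Primrec.nat_le.comp hn hi) (PrimrecPred.and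
      (PrimrecPred.or (Primrec.eq.comp hq hd)
        (Primrec.eq.comp hq (Primrec.nat_add.comp (Primrec.succ.comp hd) he)))
      (Primrec.nat_lt.comp hj hc)))
    (hget (Primrec.nat_add.comp (Primrec.nat_mul.comp hn hn) (Primrec.nat_add.comp
      (Primrec.nat_mul.comp hn hm) (Primrec.nat_add.comp
        (Primrec.nat_mul.comp (Primrec.nat_mod.comp hin hm) hc) hj))))
    (Primrec.ite (PrimrecPred.and (Primrec.eq.comp hj hi) (PrimrecPred.not
      (PrimrecPred.and (Primrec.nat_le.comp hn hi) (Primrec.eq.comp hq hd)))) h1 (Primrec.const 0))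

end Entries

theorem primrec_delayMax : Primrec delayMax := by
  have h : Primrec₂ fun (_ : List ℕ) (p : ℕ × ℕ) => max p.1 p.2 :=
    Primrec.nat_max.comp (Primrec.fst.comp Primrec.snd) (Primrec.snd.comp Primrec.snd)
  exact Primrec.list_foldl Primrec.id (Primrec.const 0) h

theorem primrec_stepTable {n m d k e : α → ℕ} {zs : α → List ℤ} (hn : Primrec n) (hm : Primrec m)
    (hd : Primrec d) (hk : Primrec k) (hz : Primrec zs) (he : Primrec e) :
    Primrec fun a => stepTable (n a) (m a) (d a) (k a) (zs a) (e a) := by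
  have hN := primrec_liftDim hn hm hd
  have h1 : Primrec fun a => (2 : ℤ) ^ k a :=
    (primrec_int_ofNat.comp (primrec_nat_pow.comp (Primrec.const 2) hk)).of_eq fun a => by simp
  have h0 : Primrec fun p : (α × ℕ) × ℕ => p.1.1 := Primrec.fst.comp Primrec.fst
  have hi : Primrec fun p : (α × ℕ) × ℕ => p.1.2 := Primrec.snd.comp Primrec.fst
  exact primrec_tableMul hN
    (primrec_tableOf hN (primrec_plantEntry (hn.comp h0) (hm.comp h0) (hd.comp h0) (h1.comp h0)
      (hz.comp h0) hi Primrec.snd))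
    (primrec_tableOf hN (primrec_controlEntry (hn.comp h0) (hm.comp h0) (hd.comp h0) (he.comp h0)
      (h1.comp h0) (hz.comp h0) hi Primrec.snd))

theorem primrec_errorBound {N k L : α → ℕ} {zs : α → List ℤ} (hN : Primrec N) (hk : Primrec k)
    (hz : Primrec zs) (hL : Primrec L) :
    Primrec fun a => errorBound (N a) (k a) (zs a) (L a) := by
  have hM : Primrec fun a => magnitude (N a) (k a) (zs a) :=
    Primrec.nat_mul.comp (Primrec.succ.comp hN) (Primrec.succ.comp (Primrec.nat_add.comp
      (primrec_nat_pow.comp (Primrec.const 2) hk) (primrec_nat_sum.comp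
        (Primrec.list_map hz (primrec_int_natAbs.comp Primrec.snd)))))
  exact Primrec.nat_mul.comp (Primrec.nat_mul.comp
    (Primrec.nat_mul.comp (Primrec.const 2) hL) hN)
    (primrec_nat_pow.comp hM (Primrec.succ.comp (Primrec.nat_mul.comp (Primrec.const 2) hL)))

section Tests

variable {c : α → ℕ × ℕ × List ℕ} {k L u e : α → ℕ} {zs : α → List ℤ}

theorem primrec_dim (hc : Primrec c) :
    Primrec fun a => liftDim (c a).1 (c a).2.1 (delayMax (c a).2.2) :=
  primrec_liftDim (Primrec.fst.comp hc) (Primrec.fst.comp (Primrec.snd.comp hc))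
    (primrec_delayMax.comp (Primrec.snd.comp (Primrec.snd.comp hc)))

theorem primrec_systemProducts (hc : Primrec c) (hk : Primrec k) (hz : Primrec zs)
    (hL : Primrec L) : Primrec fun a => systemProducts (c a) (k a) (zs a) (L a) := by
  have hD := Primrec.snd.comp (Primrec.snd.comp hc)
  have hm := Primrec.fst.comp (Primrec.snd.comp hc)
  refine primrec_tableProducts (primrec_dim hc) (Primrec.list_map hD (Primrec₂.mk ?_)) hL
  exact primrec_stepTable ((Primrec.fst.comp hc).comp Primrec.fst) (hm.comp Primrec.fst)
    ((primrec_delayMax.comp hD).comp Primrec.fst) (hk.comp Primrec.fst) (hz.comp Primrec.fst)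
    Primrec.snd

theorem primrecPred_upperTest (hc : Primrec c) (hk : Primrec k) (hz : Primrec zs)
    (hL : Primrec L) (hu : Primrec u) (he : Primrec e) :
    PrimrecPred fun a => UpperTest (c a) (k a) (zs a) (L a) (u a) (e a) := by
  have hN := primrec_dim hc
  have hE := primrec_errorBound hN hk hz hL
  have h2 := Primrec.const (α := α) 2
  have hkL := primrec_nat_pow.comp h2 (Primrec.nat_mul.comp hk
    (Primrec.nat_add.comp (Primrec.nat_mul.comp h2 hL) h2))
  have heL := primrec_nat_pow.comp h2 (Primrec.nat_mul.comp he hL)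
  have hk2 := primrec_nat_pow.comp h2 (Primrec.nat_mul.comp hk h2)
  have hrhs := Primrec.nat_mul.comp (primrec_nat_pow.comp hu hL) hkL
  have hR : PrimrecRel fun (X : List (List ℤ)) (a : α) =>
      (tableNorm (liftDim (c a).1 (c a).2.1 (delayMax (c a).2.2)) X * 2 ^ (k a * 2) +
        errorBound (liftDim (c a).1 (c a).2.1 (delayMax (c a).2.2)) (k a) (zs a) (L a)) *
          2 ^ (e a * L a) < u a ^ L a * 2 ^ (k a * (2 * L a + 2)) :=
    PrimrecPred.primrecRel (Primrec.nat_lt.comp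
      (Primrec.nat_mul.comp (Primrec.nat_add.comp (Primrec.nat_mul.comp
        (primrec_tableNorm (hN.comp Primrec.snd) Primrec.fst) (hk2.comp Primrec.snd))
        (hE.comp Primrec.snd)) (heL.comp Primrec.snd)) (hrhs.comp Primrec.snd))
  exact (PrimrecRel.forall_mem_list hR).comp (primrec_systemProducts hc hk hz hL) Primrec.id

theorem primrecPred_lowerTest (hc : Primrec c) (hk : Primrec k) (hz : Primrec zs)
    (hL : Primrec L) (hu : Primrec u) (he : Primrec e) :
    PrimrecPred fun a => LowerTest (c a) (k a) (zs a) (L a) (u a) (e a) := by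
  have hN := primrec_dim hc
  have hE := primrec_errorBound hN hk hz hL
  have h2 := Primrec.const (α := α) 2
  have hkL := primrec_nat_pow.comp h2 (Primrec.nat_mul.comp hk
    (Primrec.nat_add.comp (Primrec.nat_mul.comp h2 hL) h2))
  have heL := primrec_nat_pow.comp h2 (Primrec.nat_mul.comp he hL)
  have hk2 := primrec_nat_pow.comp h2 (Primrec.nat_mul.comp hk h2)
  have hlhs := Primrec.nat_mul.comp hN (Primrec.nat_add.comp
    (Primrec.nat_mul.comp (primrec_nat_pow.comp hu hL) hkL) (Primrec.nat_mul.comp hE heL))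
  have hR : PrimrecRel fun (X : List (List ℤ)) (a : α) =>
      liftDim (c a).1 (c a).2.1 (delayMax (c a).2.2) * (u a ^ L a * 2 ^ (k a * (2 * L a + 2)) +
        errorBound (liftDim (c a).1 (c a).2.1 (delayMax (c a).2.2)) (k a) (zs a) (L a) *
          2 ^ (e a * L a)) <
        (tableTrace (liftDim (c a).1 (c a).2.1 (delayMax (c a).2.2)) X).natAbs * 2 ^ (k a * 2) *
          2 ^ (e a * L a) :=
    PrimrecPred.primrecRel (Primrec.nat_lt.comp (hlhs.comp Primrec.snd)
      (Primrec.nat_mul.comp (Primrec.nat_mul.comp (primrec_int_natAbs.comp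
        (primrec_tableTrace (hN.comp Primrec.snd) Primrec.fst)) (hk2.comp Primrec.snd))
        (heL.comp Primrec.snd)))
  exact (PrimrecRel.exists_mem_list hR).comp (primrec_systemProducts hc hk hz hL) Primrec.id

end Tests

end Computability

/-! ### Search over precisions and parameters -/

section Search

variable {α β : Type} [Primcodable α] [Primcodable β]

/-- The algorithm that tries out all pairs of a precision `p` and a parameter `t` on the `p`-th
approximation of the input. -/
def searchAlgorithm (T : α × (ℕ × ℕ) × List ℤ → Option β) (hT : Primrec T) :
    RealAlgorithm α β where
  -- The length of the segment read so far codes the pair `(p, t)`; if the `p`-th approximation is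
  -- not in the segment, the lookup returns `none` and the search goes on.
  step q := (q.2[(Nat.unpair q.2.length).1]?).bind fun zs => T (q.1, Nat.unpair q.2.length, zs)
  computable := by
    have hu : Primrec fun q : α × List (List ℤ) => Nat.unpair q.2.length :=
      Primrec.unpair.comp (Primrec.list_length.comp Primrec.snd)
    have h : Primrec₂ fun (q : α × List (List ℤ)) (zs : List ℤ) =>
        T (q.1, Nat.unpair q.2.length, zs) :=
      hT.comp (Primrec.pair (Primrec.fst.comp Primrec.fst)
        (Primrec.pair (hu.comp Primrec.fst) Primrec.snd))
    exact (Primrec.option_bind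
      (Primrec.list_getElem?.comp Primrec.snd (Primrec.fst.comp hu)) h).to_comp

theorem exists_mem_searchAlgorithm_run (T : α × (ℕ × ℕ) × List ℤ → Option β) (hT : Primrec T)
    (a : α) (φ : ℕ → List ℤ)
    (h : ∃ t, ∀ᶠ p in Filter.atTop, (T (a, (p, t), φ p)).isSome) :
    ∃ b ∈ (searchAlgorithm T hT).run a φ, ∃ p t, T (a, (p, t), φ p) = some b := by
  have hstep : ∀ k b, b ∈ (searchAlgorithm T hT).step (a, (List.range k).map φ) →
      ∃ p t, T (a, (p, t), φ p) = some b := by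
    intro k b hb
    obtain ⟨zs, hzs, hb⟩ := Option.bind_eq_some_iff.mp hb
    simp only [List.length_map, List.length_range] at hzs hb
    rw [List.getElem?_map] at hzs
    obtain ⟨i, hi, rfl⟩ := Option.map_eq_some_iff.mp hzs
    obtain ⟨hi1, hi2⟩ := List.getElem?_eq_some_iff.mp hi
    rw [List.getElem_range] at hi2
    subst hi2
    exact ⟨_, _, hb⟩
  obtain ⟨t, ht⟩ := h
  obtain ⟨p, hp, hp1⟩ := (ht.and (Filter.eventually_ge_atTop 1)).exists
  obtain ⟨b, hb⟩ := Option.isSome_iff_exists.mp hp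
  -- Strict inequality puts index `p` inside a segment of length `Nat.pair p t`; it fails for `p = t
  -- = 0`, hence the requirement `1 ≤ p`.
  have hlt : p < Nat.pair p t := by
    have h1 : p ≤ Nat.pair p t := Nat.left_le_pair p t
    have := Nat.unpair_lt (n := Nat.pair p t) (by omega)
    rwa [Nat.unpair_pair] at this
  have hdom : ((searchAlgorithm T hT).run a φ).Dom := by
    refine Nat.rfindOpt_dom.mpr ⟨Nat.pair p t, b, ?_⟩
    simp only [searchAlgorithm, List.length_map, List.length_range, Nat.unpair_pair]
    rw [List.getElem?_map, List.getElem?_range hlt]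
    exact hb
  refine ⟨((searchAlgorithm T hT).run a φ).get hdom, Part.get_mem hdom, ?_⟩
  obtain ⟨k, hk⟩ := Nat.rfindOpt_spec (Part.get_mem hdom)
  exact hstep k _ hk

end Search

/-! ### The two algorithms -/

open Classical in
/-- Looks for a number `j / 2 ^ c` close to the growth rate. -/
noncomputable def rateTest (c : ℕ) (q : (ℕ × ℕ × List ℕ) × (ℕ × ℕ) × List ℤ) : Option (ℤ × ℕ) :=
  -- The parameter codes two lengths and `j`. The tests place the growth rate between `(j - 1) / 2 ^
  -- c` and `(j + 1) / 2 ^ c`; for `j ≤ 1` the lower bound is trivial.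
  if UpperTest q.1 q.2.1.1 q.2.2 (q.2.1.2.unpair.1.unpair.1 + 1) (q.2.1.2.unpair.2 + 1) c ∧
      (q.2.1.2.unpair.2 ≤ 1 ∨
        LowerTest q.1 q.2.1.1 q.2.2 (q.2.1.2.unpair.1.unpair.2 + 1) (q.2.1.2.unpair.2 - 1) c) then
    some ((q.2.1.2.unpair.2 : ℤ), 2 ^ c - 1) else none

open Classical in
/-- Decides between growth at most at a rate little above the first real number of the input, and
growth at least at a rate little below it. -/
noncomputable def decisionTest (c : ℕ) (q : (ℕ × ℕ × List ℕ) × (ℕ × ℕ) × List ℤ) : Option Bool :=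
  -- The head `z` satisfies `z - 1 ≤ r * 2 ^ p ≤ z + 1`. Subtracting `1` here keeps the tested rate
  -- at most `r + 1 / 2 ^ c`.
  if UpperTest q.1 q.2.1.1 q.2.2.tail (q.2.1.2 + 1)
      (q.2.2.headI.toNat + 2 ^ q.2.1.1 / 2 ^ c - 1) q.2.1.1 then some true
  -- The first `+ 1` keeps the tested rate at least `r - 1 / 2 ^ c`. The last one, outside the
  -- truncated subtraction, makes it positive, as the compactness argument requires.
  else if LowerTest q.1 q.2.1.1 q.2.2.tail (q.2.1.2 + 1)
      (q.2.2.headI.toNat + 1 - 2 ^ q.2.1.1 / 2 ^ c + 1) q.2.1.1 then some false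
  else none

open Classical in
theorem primrec_rateTest (c : ℕ) : Primrec (rateTest c) := by
  have ha : Primrec fun q : (ℕ × ℕ × List ℕ) × (ℕ × ℕ) × List ℤ => q.1 := Primrec.fst
  have hp : Primrec fun q : (ℕ × ℕ × List ℕ) × (ℕ × ℕ) × List ℤ => q.2.1.1 :=
    Primrec.fst.comp (Primrec.fst.comp Primrec.snd)
  have ht : Primrec fun q : (ℕ × ℕ × List ℕ) × (ℕ × ℕ) × List ℤ => q.2.1.2.unpair :=
    Primrec.unpair.comp (Primrec.snd.comp (Primrec.fst.comp Primrec.snd))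
  have hz : Primrec fun q : (ℕ × ℕ × List ℕ) × (ℕ × ℕ) × List ℤ => q.2.2 :=
    Primrec.snd.comp Primrec.snd
  have hL := Primrec.unpair.comp (Primrec.fst.comp ht)
  have hj := Primrec.snd.comp ht
  refine Primrec.ite (PrimrecPred.and (primrecPred_upperTest ha hp hz
      (Primrec.succ.comp (Primrec.fst.comp hL)) (Primrec.succ.comp hj) (Primrec.const c))
    (PrimrecPred.or (Primrec.nat_le.comp hj (Primrec.const 1)) (primrecPred_lowerTest ha hp hz
      (Primrec.succ.comp (Primrec.snd.comp hL)) (Primrec.nat_sub.comp hj (Primrec.const 1))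
      (Primrec.const c)))) ?_ (Primrec.const none)
  exact Primrec.option_some.comp (Primrec.pair (primrec_int_ofNat.comp hj) (Primrec.const _))

open Classical in
theorem primrec_decisionTest (c : ℕ) : Primrec (decisionTest c) := by
  have ha : Primrec fun q : (ℕ × ℕ × List ℕ) × (ℕ × ℕ) × List ℤ => q.1 := Primrec.fst
  have hp : Primrec fun q : (ℕ × ℕ × List ℕ) × (ℕ × ℕ) × List ℤ => q.2.1.1 :=
    Primrec.fst.comp (Primrec.fst.comp Primrec.snd)
  have hL : Primrec fun q : (ℕ × ℕ × List ℕ) × (ℕ × ℕ) × List ℤ => q.2.1.2 + 1 :=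
    Primrec.succ.comp (Primrec.snd.comp (Primrec.fst.comp Primrec.snd))
  have hz : Primrec fun q : (ℕ × ℕ × List ℕ) × (ℕ × ℕ) × List ℤ => q.2.2 :=
    Primrec.snd.comp Primrec.snd
  have hr := primrec_int_toNat.comp (Primrec.list_headI.comp hz)
  have hη := Primrec.nat_div.comp (primrec_nat_pow.comp (Primrec.const 2) hp)
    (Primrec.const (2 ^ c))
  exact Primrec.ite (primrecPred_upperTest ha hp (Primrec.list_tail.comp hz) hL
      (Primrec.nat_sub.comp (Primrec.nat_add.comp hr hη) (Primrec.const 1)) hp)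
    (Primrec.const _) (Primrec.ite (primrecPred_lowerTest ha hp (Primrec.list_tail.comp hz) hL
      (Primrec.succ.comp (Primrec.nat_sub.comp (Primrec.succ.comp hr) hη)) hp)
      (Primrec.const _) (Primrec.const _))

namespace SwitchedDelay

variable {n m : ℕ} {S : SwitchedDelay n m} {K : S.Controller} {φ : ℕ → List ℤ}

theorem rateTest_sound (hφ : IsName φ (S.realData K)) {c p t : ℕ} {b : ℤ × ℕ}
    (hb : rateTest c (S.discreteData, (p, t), φ p) = some b) :
    |((fractionValue b : ℚ) : ℝ) - S.worstGrowthRate K| ≤ 1 / 2 ^ c := by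
  rw [rateTest] at hb
  dsimp only at hb
  set j := t.unpair.2
  split_ifs at hb with hc
  obtain ⟨hup, hlow⟩ := hc
  obtain rfl := Option.some_injective _ hb
  have hval : ((fractionValue ((j : ℤ), 2 ^ c - 1) : ℚ) : ℝ) = j / 2 ^ c := by
    have h1 : ((2 ^ c - 1 : ℕ) : ℝ) + 1 = 2 ^ c := by
      rw [← Nat.cast_succ, Nat.succ_eq_add_one, Nat.sub_add_cancel Nat.one_le_two_pow]
      push_cast
      rfl
    rw [fractionValue]
    push_cast
    rw [h1]
  have hle : S.worstGrowthRate K ≤ j / 2 ^ c + 1 / 2 ^ c := by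
    rw [← add_div]
    have h1 := growthAtMost_of_productsBounded (productsBounded_of_upperTest (hφ p) (by omega) hup)
    push_cast at h1
    exact worstGrowthRate_le (by positivity) h1
  have hge : (j : ℝ) / 2 ^ c - 1 / 2 ^ c ≤ S.worstGrowthRate K := by
    rw [← sub_div]
    by_cases hj : j ≤ 1
    · have h1 : (j : ℝ) ≤ 1 := by exact_mod_cast hj
      refine le_trans ?_ worstGrowthRate_nonneg
      exact div_nonpos_of_nonpos_of_nonneg (by linarith) (by positivity)
    · have h1 := not_productsBounded_of_lowerTest (hφ p) (hlow.resolve_left hj)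
      rw [Nat.cast_sub (by omega), Nat.cast_one] at h1
      have h2 : (1 : ℝ) < j := by exact_mod_cast (not_le.mp hj)
      exact le_worstGrowthRate (growthAtLeast_of_not_productsBounded
        (div_pos (by linarith) (by positivity)) h1)
  rw [hval, abs_le]
  constructor <;> linarith

theorem rateTest_complete (hφ : IsName φ (S.realData K)) (c : ℕ) :
    ∃ t, ∀ᶠ p in Filter.atTop, (rateTest c (S.discreteData, (p, t), φ p)).isSome := by
  classical
  -- For the least such `j`, the offset `1 / 2` leaves a gap on both sides: boundedness at `j + 1 /
  -- 2` triggers the upper test at `j + 1`, and its failure at `j - 1 / 2` triggers the lower test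
  -- at `j - 1`.
  have hex : ∃ j : ℕ, ProductsBounded (S.liftFamily K) ((j + 1 / 2) / 2 ^ c) := by
    obtain ⟨s, hs, hb⟩ := exists_productsBounded (S.liftFamily K)
    obtain ⟨j, hj⟩ := exists_nat_gt (s * 2 ^ c)
    refine ⟨j, hb.mono hs.le ?_⟩
    rw [le_div_iff₀ (by positivity)]
    linarith
  set j := Nat.find hex with hj
  have hc : (0 : ℝ) < 2 ^ c := by positivity
  obtain ⟨L₁, hL₁⟩ := eventually_upperTest hφ (s' := (j + 1) / 2 ^ c) (by positivity)
    (by gcongr; norm_num) (Nat.find_spec hex)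
  have hlow : ∃ L₂, ∀ᶠ p in Filter.atTop, j ≤ 1 ∨
      LowerTest S.discreteData p (φ p) (L₂ + 1) (j - 1) c := by
    by_cases hj1 : j ≤ 1
    · exact ⟨0, Filter.Eventually.of_forall fun _ => Or.inl hj1⟩
    · have h1 := Nat.find_min hex (show j - 1 < Nat.find hex by omega)
      have h2 : (1 : ℝ) < j := by exact_mod_cast (not_le.mp hj1)
      rw [Nat.cast_sub (by omega), Nat.cast_one] at h1
      obtain ⟨L₂, hL₂⟩ := eventually_lowerTest hφ (s := ((j : ℝ) - 1) / 2 ^ c)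
        (div_pos (by linarith) hc) (by gcongr; linarith) h1
      refine ⟨L₂, hL₂.mono fun p hp => Or.inr (hp _ _ ?_)⟩
      rw [Nat.cast_sub (by omega), Nat.cast_one]
  obtain ⟨L₂, hL₂⟩ := hlow
  refine ⟨Nat.pair (Nat.pair L₁ L₂) j, ?_⟩
  filter_upwards [hL₁, hL₂] with p hp1 hp2
  have h1 := hp1 (j + 1) c (by push_cast; exact le_rfl)
  rw [rateTest]
  simp only [Nat.unpair_pair]
  rw [if_pos ⟨h1, hp2⟩]
  rfl

variable {r : ℝ}

theorem decisionTest_sound (hr : 0 < r) (hφ : IsName φ (r :: S.realData K)) {c p t : ℕ} {b : Bool}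
    (hb : decisionTest c (S.discreteData, (p, t), φ p) = some b) :
    (b = true → S.GrowthAtMost K (r + 1 / 2 ^ c)) ∧
      (b = false → S.GrowthAtLeast K (max (r - 1 / 2 ^ c) 0)) := by
  obtain ⟨z, zs, hz, hzs, hφp⟩ := List.forall₂_cons_right_iff.mp (hφ p)
  have hp : (0 : ℝ) < 2 ^ p := by positivity
  have hc : (0 : ℝ) < 2 ^ c := by positivity
  have hη : ((2 ^ p / 2 ^ c : ℕ) : ℝ) ≤ 2 ^ p / 2 ^ c := by
    refine Nat.cast_div_le.trans ?_
    push_cast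
    exact le_rfl
  have hz1 : (z : ℝ) - 1 ≤ r * 2 ^ p ∧ r * 2 ^ p ≤ z + 1 := by
    have h1 := abs_le.mp hz
    have h2 : (z : ℝ) / 2 ^ p * 2 ^ p = z := div_mul_cancel₀ _ hp.ne'
    have h3 : 1 / (2 : ℝ) ^ p * 2 ^ p = 1 := div_mul_cancel₀ _ hp.ne'
    constructor <;> nlinarith [h1.1, h1.2]
  have hz0 : 0 ≤ z := by
    have h1 : (-1 : ℝ) < z := by nlinarith [hz1.2, mul_pos hr hp]
    have h2 : (-1 : ℤ) < z := by exact_mod_cast h1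
    omega
  have hzn : ((z.toNat : ℕ) : ℝ) = z := by exact_mod_cast Int.toNat_of_nonneg hz0
  rw [decisionTest] at hb
  dsimp only at hb
  rw [hφp, List.tail_cons, List.headI_cons] at hb
  split_ifs at hb with h1 h2
  · obtain rfl := Option.some_injective _ hb
    refine ⟨fun _ => ?_, fun h => absurd h (by simp)⟩
    have hu := pos_of_upperTest (by omega) h1
    have h3 := growthAtMost_of_productsBounded (productsBounded_of_upperTest hzs (by omega) h1)
    refine h3.mono (by positivity) ?_
    rw [div_le_iff₀ hp, Nat.cast_sub (by omega)]
    push_cast at hη ⊢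
    rw [hzn, add_mul, one_div_mul_eq_div]
    linarith [hz1.1]
  · obtain rfl := Option.some_injective _ hb
    refine ⟨fun h => absurd h (by simp), fun _ => ?_⟩
    have h3 := growthAtLeast_of_not_productsBounded (by positivity)
      (not_productsBounded_of_lowerTest hzs h2)
    refine h3.mono (le_max_right _ _) (max_le ?_ (by positivity))
    rw [le_div_iff₀ hp, sub_mul, one_div_mul_eq_div]
    have h4 : ((z.toNat + 1 : ℕ) : ℝ) ≤
        ((z.toNat + 1 - 2 ^ p / 2 ^ c + 1 : ℕ) : ℝ) + ((2 ^ p / 2 ^ c : ℕ) : ℝ) := by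
      rw [← Nat.cast_add, Nat.cast_le]
      omega
    rw [Nat.cast_succ, hzn] at h4
    linarith [hz1.2]

theorem decisionTest_complete (hr : 0 < r) (hφ : IsName φ (r :: S.realData K)) (c : ℕ) :
    ∃ t, ∀ᶠ p in Filter.atTop, (decisionTest c (S.discreteData, (p, t), φ p)).isSome := by
  have hc : (0 : ℝ) < 1 / 2 ^ c := by positivity
  have hφ' : IsName (fun p => (φ p).tail) (S.realData K) := by
    intro p
    obtain ⟨z, zs, -, hzs, hφp⟩ := List.forall₂_cons_right_iff.mp (hφ p)
    simpa only [hφp, List.tail_cons] using hzs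
  have hhead : ∀ p, r * 2 ^ p - 1 ≤ (φ p).headI.toNat ∧
      ((φ p).headI.toNat : ℝ) ≤ r * 2 ^ p + 1 := by
    intro p
    obtain ⟨z, zs, hz, -, hφp⟩ := List.forall₂_cons_right_iff.mp (hφ p)
    rw [hφp, List.headI_cons]
    have hp : (0 : ℝ) < 2 ^ p := by positivity
    have h1 := abs_le.mp hz
    have h2 : (z : ℝ) / 2 ^ p * 2 ^ p = z := div_mul_cancel₀ _ hp.ne'
    have h3 : 1 / (2 : ℝ) ^ p * 2 ^ p = 1 := div_mul_cancel₀ _ hp.ne'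
    have h4 : r * 2 ^ p - 1 ≤ z := by nlinarith [h1.1, h1.2]
    have h5 : (z : ℝ) ≤ r * 2 ^ p + 1 := by nlinarith [h1.1, h1.2]
    have h6 : ((z.toNat : ℕ) : ℝ) = max (z : ℝ) 0 := by
      exact_mod_cast congrArg (Int.cast (R := ℝ)) (Int.toNat_eq_max z)
    rw [h6]
    have h7 := mul_pos hr hp
    exact ⟨h4.trans (le_max_left _ _), max_le h5 (by linarith)⟩
  have hη : ∀ p ≥ c, ((2 ^ p / 2 ^ c : ℕ) : ℝ) = 1 / 2 ^ c * 2 ^ p := by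
    intro p hp
    rw [Nat.cast_div (pow_dvd_pow 2 hp) (by positivity)]
    push_cast
    ring
  have hpow : ∀ {x : ℝ}, 0 < x → ∀ y : ℝ, ∀ᶠ p : ℕ in Filter.atTop, y ≤ x * 2 ^ p := fun hx y =>
    ((tendsto_pow_atTop_atTop_of_one_lt one_lt_two).const_mul_atTop hx).eventually_ge_atTop y
  -- The case split is at the midpoint of `r` and `r + 1 / 2 ^ c`. For large `p` the rounding is
  -- negligible: the upper test is made at a rate above three quarters of that interval, the lower
  -- test at a rate not exceeding `r`.
  by_cases hb : ProductsBounded (S.liftFamily K) (r + 1 / 2 ^ c / 2)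
  · obtain ⟨L, hL⟩ := eventually_upperTest hφ' (s' := r + 1 / 2 ^ c * (3 / 4)) (by positivity)
      (by linarith) hb
    refine ⟨L, ?_⟩
    filter_upwards [hL, Filter.eventually_ge_atTop c, hpow (x := 1 / 2 ^ c / 4) (by positivity) 2]
      with p hp hpc hp2
    have hp0 : (0 : ℝ) < 2 ^ p := by positivity
    have h1 := hp ((φ p).headI.toNat + 2 ^ p / 2 ^ c - 1) p (by
      rw [le_div_iff₀ hp0]
      have h2 : (((φ p).headI.toNat + 2 ^ p / 2 ^ c : ℕ) : ℝ) ≤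
          ((φ p).headI.toNat + 2 ^ p / 2 ^ c - 1 : ℕ) + 1 := by
        rw [← Nat.cast_succ, Nat.cast_le]; omega
      rw [Nat.cast_add, hη p hpc] at h2
      linarith [(hhead p).1])
    rw [decisionTest, if_pos h1]
    rfl
  · obtain ⟨L, hL⟩ := eventually_lowerTest hφ' hr (by linarith) hb
    refine ⟨L, ?_⟩
    filter_upwards [hL, Filter.eventually_ge_atTop c, hpow hc 3, hpow hr 1]
      with p hp hpc hp2 hp3
    have hp0 : (0 : ℝ) < 2 ^ p := by positivity
    have h1 := hp ((φ p).headI.toNat + 1 - 2 ^ p / 2 ^ c + 1) p (by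
      rw [div_le_iff₀ hp0]
      rcases le_total (2 ^ p / 2 ^ c) ((φ p).headI.toNat + 1) with h2 | h2
      · rw [Nat.cast_succ, Nat.cast_sub h2, hη p hpc]
        push_cast
        linarith [(hhead p).2]
      · rw [Nat.sub_eq_zero_of_le h2]
        push_cast
        linarith)
    rw [decisionTest]
    -- The upper test may succeed here as well; `decisionTest_sound` covers either answer.
    split_ifs <;> rfl

end SwitchedDelay

theorem mainTheorem5 (ε : ℝ) (hε : 0 < ε) :
    (∃ M : RealAlgorithm (ℕ × ℕ × List ℕ) (ℤ × ℕ),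
      ∀ (n m : ℕ) (S : SwitchedDelay n m) (K : S.Controller) (φ : ℕ → List ℤ),
        IsName φ (S.realData K) →
          ∃ c ∈ M.run S.discreteData φ,
            |((fractionValue c : ℚ) : ℝ) - S.worstGrowthRate K| ≤ ε) ∧
    (∃ M : RealAlgorithm (ℕ × ℕ × List ℕ) Bool,
      ∀ (n m : ℕ) (S : SwitchedDelay n m) (K : S.Controller) (r : ℝ) (φ : ℕ → List ℤ),
        0 < r → IsName φ (r :: S.realData K) →
          ∃ b ∈ M.run S.discreteData φ,
            (b = true → S.GrowthAtMost K (r + ε)) ∧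
            (b = false → S.GrowthAtLeast K (max (r - ε) 0))) := by
  -- Only the natural number `c` enters the algorithms, so `ε` need not be computable.
  obtain ⟨c, hc⟩ := exists_pow_lt_of_lt_one hε (show (1 / 2 : ℝ) < 1 by norm_num)
  have hcε : 1 / 2 ^ c ≤ ε := by rw [one_div, ← inv_pow, ← one_div]; exact hc.le
  refine ⟨⟨searchAlgorithm (rateTest c) (primrec_rateTest c), fun n m S K φ hφ => ?_⟩,
    ⟨searchAlgorithm (decisionTest c) (primrec_decisionTest c), fun n m S K r φ hr hφ => ?_⟩⟩
  · obtain ⟨b, hb, p, t, hT⟩ := exists_mem_searchAlgorithm_run (rateTest c) (primrec_rateTest c)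
      S.discreteData φ (SwitchedDelay.rateTest_complete hφ c)
    exact ⟨b, hb, (SwitchedDelay.rateTest_sound hφ hT).trans hcε⟩
  · obtain ⟨b, hb, p, t, hT⟩ := exists_mem_searchAlgorithm_run (decisionTest c)
      (primrec_decisionTest c) S.discreteData φ (SwitchedDelay.decisionTest_complete hr hφ c)
    obtain ⟨h1, h2⟩ := SwitchedDelay.decisionTest_sound hr hφ hT
    refine ⟨b, hb, fun h => (h1 h).mono (by positivity) (by linarith), fun h => (h2 h).mono
      (le_max_right _ _) (max_le_max_right _ (by linarith))⟩
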